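/- **Orthoalgebras.** An orthoalgebra is a set $A$ with a partial binary operation $\oplus$, a unary operation $'$ and constants $0,1$ such that $\oplus$ is commutative and associative (if one side is defined so is the other, and they are equal), $a'$ is the unique element with $a\oplus a'$ defined and equal to $1$, and $a\oplus a$ is defined if and only if $a=0$. It is Boolean if it arises from a Boolean algebra by restricting the join to pairs of orthogonal elements. A Boolean subalgebra of $A$ is a subset containing $0,1$, closed under $'$ and existing sums $\oplus$, that is a Boolean orthoalgebra under the restricted operations; $\mathrm{BSub}(A)$ is the set of Boolean subalgebras ordered by inclusion. $A$ is proper if every maximal Boolean subalgebra has more than $4$ elements. **Orthodomains.** A Boolean domain is a poset isomorphic to the lattice of subalgebras of a Boolean algebra. An orthodomain is a poset $X$ with least element $\bot$ such that every directed subset has a join; $X$ is atomistic with compact atoms; each $\downarrow x$ is a Boolean domain; and if $x,y$ are distinct atoms covered by $w$, then $x\vee y=w$. For a poset $P$, $P^*$ is the set of elements of $P$ of height at most $3$, with the induced order; $X$ is short if $X=X^*$. An element is basic if it is $\bot$ or an atom. **Directions.** An element $x$ of a lattice is dual modular if $(x\vee y)\wedge z=x\vee(y\wedge z)$ whenever $x\le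 z$ and $(w\vee x)\wedge y=w\vee(x\wedge y)$ whenever $w\le y$. A principal pair for $x$ in a Boolean domain is a pair $(y,z)$ of dual modular elements with $y\wedge z=x$ such that $y=\top$ and $z$ is basic, or $z=\top$ and $y$ is basic, or $y\vee z=\top$ and $y\wedge z$ is basic and not dual modular. A direction for a basic element $x$ of an orthodomain $X$ is a map $d:\uparrow x\to X^2$ such that for all $y,z\in\uparrow x$: (i) $d(y)$ is a principal pair for $x$ in $\downarrow y$; (ii) if $y\le z$ and $d(z)=(v,w)$ then $d(y)=(y\wedge v,y\wedge w)$; (iii) if $y,z$ cover $x$, $d(y)=(x,y)$ and $d(z)=(z,x)$, then $y\vee z$ exists and covers $y$ and $z$. $X$ has enough directions if no maximal element of $X$ is basic and each basic element has a direction. Let $\mathrm{Dir}(X)$ be the set of all directions for basic elements of $X$. Let $0,1\in\mathrm{Dir}(X)$ be the directions for $\bot$ with $0(w)=(\bot,w)$ and $1(w)=(w,\bot)$, let $d'(w)=(z,y)$ when $d(w)=(y,z)$, and define $\oplus$ by: $d\oplus 0=d=0\oplus d$; $d\oplus d'=1$; and, if $d,e$ are directions for distinct atoms $x,y$ whose join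 $w$ exists and covers both, $z$ is the third atom below $w$, $d(w)=(x,w)$ and $e(w)=(y,w)$, then $d\oplus e$ is the direction for $z$ with $(d\oplus e)(w)=(w,z)$. In no other case is $d\oplus e$ defined. **Theorem.** The following are equivalent for an orthodomain $X$: 1. $X$ is short and has enough directions; 2. $X\cong\mathrm{BSub}(A)^*$ for a proper orthoalgebra $A$. When these conditions hold, $\mathrm{Dir}(X)$ with the above operations is an orthoalgebra and $X\cong\mathrm{BSub}(\mathrm{Dir}(X))^*$. -/

import Mathlib

universe u

/-! ### Orthoalgebras and their Boolean subalgebras -/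

/-- The data of an orthoalgebra. The partial operation `⊕` is given by its graph:
`osum a b c` says that `a ⊕ b` is defined and equal to `c`. -/
class OrthoData (A : Type u) where
  ozero : A
  oone : A
  ocompl : A → A
  osum : A → A → A → Prop

open OrthoData

/-- The laws of an orthoalgebra. -/
structure IsOrthoalgebra (A : Type u) [OrthoData A] : Prop where
  /-- `⊕` is a partial function. -/
  sum_unique : ∀ a b c c' : A, osum a b c → osum a b c' → c = c'
  sum_comm : ∀ a b c : A, osum a b c → osum b a c
  /-- If `(a ⊕ b) ⊕ c` is defined, so is `a ⊕ (b ⊕ c)`, with the same value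
  (the reverse implication follows by commutativity). -/
  sum_assoc : ∀ a b c s t : A, osum a b s → osum s c t → ∃ r, osum b c r ∧ osum a r t
  /-- `a'` is the unique element with `a ⊕ a' = 1`. -/
  sum_eq_one_iff : ∀ a b : A, osum a b oone ↔ b = ocompl a
  /-- `a ⊕ a` is defined if and only if `a = 0`. -/
  sum_self_iff : ∀ a : A, (∃ c, osum a a c) ↔ a = ozero

/-- The structure arises from a Boolean algebra (on the same set) by restricting the join to pairs
of orthogonal elements. -/
def IsBooleanOrtho (A : Type u) [OrthoData A] : Prop :=
  ∃ _ : BooleanAlgebra A, (ozero : A) = ⊥ ∧ (oone : A) = ⊤ ∧ (∀ a : A, ocompl a = aᶜ) ∧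
    ∀ a b c : A, osum a b c ↔ Disjoint a b ∧ a ⊔ b = c

/-- A subalgebra: a subset containing `0`, `1`, and closed under `'` and existing `⊕`. -/
structure OrthoSubalgebra (A : Type u) [OrthoData A] where
  carrier : Set A
  zero_mem : ozero ∈ carrier
  one_mem : oone ∈ carrier
  compl_mem : ∀ a ∈ carrier, ocompl a ∈ carrier
  sum_mem : ∀ a ∈ carrier, ∀ b ∈ carrier, ∀ c, osum a b c → c ∈ carrier

/-- The operations of `A` restricted to a subalgebra. -/
instance OrthoSubalgebra.orthoData {A : Type u} [OrthoData A] (S : OrthoSubalgebra A) :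
    OrthoData S.carrier where
  ozero := ⟨ozero, S.zero_mem⟩
  oone := ⟨oone, S.one_mem⟩
  ocompl a := ⟨ocompl a.1, S.compl_mem a.1 a.2⟩
  osum a b c := osum a.1 b.1 c.1

/-- The Boolean subalgebras of `A`. -/
def BSub (A : Type u) [OrthoData A] : Type u :=
  {S : OrthoSubalgebra A // IsBooleanOrtho S.carrier}

/-- The underlying subset of a Boolean subalgebra. -/
def BSub.carrier {A : Type u} [OrthoData A] (S : BSub A) : Set A := S.1.carrier

theorem BSub.carrier_injective {A : Type u} [OrthoData A] :
    Function.Injective (BSub.carrier : BSub A → Set A) := by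
  rintro ⟨⟨s, _, _, _, _⟩, hs⟩ ⟨⟨t, _, _, _, _⟩, ht⟩ h
  change s = t at h
  subst h
  rfl

/-- Boolean subalgebras are ordered by inclusion. -/
instance BSub.partialOrder {A : Type u} [OrthoData A] : PartialOrder (BSub A) :=
  PartialOrder.lift BSub.carrier BSub.carrier_injective

/-- `A` has no small block: every maximal Boolean subalgebra has more than four elements. -/
def IsProperOrthoalgebra (A : Type u) [OrthoData A] : Prop :=
  ∀ S : BSub A, IsMax S → 4 < S.carrier.encard

/-! ### Boolean domains and principal pairs -/

/-- A Boolean domain: a poset isomorphic to the lattice of subalgebras of a Boolean algebra. -/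
def IsBooleanDomain (L : Type u) [PartialOrder L] : Prop :=
  ∃ (B : Type u) (_ : BooleanAlgebra B), Nonempty (L ≃o BooleanSubalgebra B)

/-- A basic element: the least element or an atom. -/
def IsBasic {L : Type u} [PartialOrder L] [OrderBot L] (x : L) : Prop :=
  x = ⊥ ∨ IsAtom x

/-- Dual modular elements, for a poset in which binary joins and meets exist:
`(x ∨ y) ∧ z = x ∨ (y ∧ z)` for `x ≤ z`, and `(w ∨ x) ∧ y = w ∨ (x ∧ y)` for `w ≤ y`. -/
structure IsDualModular {L : Type u} [PartialOrder L] (x : L) : Prop where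
  left : ∀ y z j m n : L, x ≤ z → IsLUB {x, y} j → IsGLB {j, z} m → IsGLB {y, z} n →
    IsLUB {x, n} m
  right : ∀ w y j m n : L, w ≤ y → IsLUB {w, x} j → IsGLB {j, y} m → IsGLB {x, y} n →
    IsLUB {w, n} m

/-- Principal pairs of a Boolean domain. -/
structure IsPrincipalPair {L : Type u} [PartialOrder L] [BoundedOrder L] (y z : L) : Prop where
  left : IsDualModular y
  right : IsDualModular z
  cases : (y = ⊤ ∧ IsBasic z) ∨ (z = ⊤ ∧ IsBasic y) ∨
    (IsLUB {y, z} ⊤ ∧ ∃ x, IsGLB {y, z} x ∧ IsBasic x ∧ ¬ IsDualModular x)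

/-- `(y, z)` is a principal pair for `x`, that is, one with `y ∧ z = x`. -/
def IsPrincipalPairFor {L : Type u} [PartialOrder L] [BoundedOrder L] (x y z : L) : Prop :=
  IsPrincipalPair y z ∧ IsGLB {y, z} x

/-! ### Orthodomains and directions -/

structure IsOrthodomain (X : Type u) [PartialOrder X] [OrderBot X] : Prop where
  directed_join : ∀ s : Set X, s.Nonempty → DirectedOn (· ≤ ·) s → ∃ u, IsLUB s u
  atomistic : IsAtomistic X
  atom_compact : ∀ a : X, IsAtom a → IsCompactElement a
  booleanDomain_Iic : ∀ x : X, IsBooleanDomain (Set.Iic x)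
  isLUB_of_covBy : ∀ x y w : X, IsAtom x → IsAtom y → x ≠ y → x ⋖ w → y ⋖ w → IsLUB {x, y} w

/-- The elements of height at most `3`, with the induced order. -/
abbrev ShortPart (X : Type u) [PartialOrder X] : Type u :=
  {x : X // Order.height x ≤ 3}

/-- `X` is short: every element has height at most `3`. -/
def IsShort (X : Type u) [PartialOrder X] : Prop :=
  ∀ x : X, Order.height x ≤ 3

/-- The value `(v, w)` is a principal pair for `x` in `↓y`. -/
def IsPrincipalPairBelow {X : Type u} [PartialOrder X] [OrderBot X] (x y : X) (p : X × X) : Prop :=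
  ∃ (hx : x ≤ y) (h₁ : p.1 ≤ y) (h₂ : p.2 ≤ y),
    IsPrincipalPairFor (L := Set.Iic y) ⟨x, hx⟩ ⟨p.1, h₁⟩ ⟨p.2, h₂⟩

/-- A direction of `X`: a basic element `base` with a map `val` from `↑base` to `X × X`. -/
@[ext]
structure ODir (X : Type u) [PartialOrder X] [OrderBot X] where
  base : X
  basic : IsBasic base
  val : Set.Ici base → X × X
  principal : ∀ y, IsPrincipalPairBelow base y.1 (val y)
  restrict : ∀ y z, y ≤ z →
    IsGLB {y.1, (val z).1} (val y).1 ∧ IsGLB {y.1, (val z).2} (val y).2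
  join : ∀ y z, base ⋖ y.1 → base ⋖ z.1 → val y = (base, y.1) → val z = (z.1, base) →
    ∃ u, IsLUB {y.1, z.1} u ∧ y.1 ⋖ u ∧ z.1 ⋖ u

/-- No maximal element is basic. -/
def IsProperOrthodomain (X : Type u) [PartialOrder X] [OrderBot X] : Prop :=
  ∀ x : X, IsMax x → ¬ IsBasic x

def HasEnoughDirections (X : Type u) [PartialOrder X] [OrderBot X] : Prop :=
  IsProperOrthodomain X ∧ ∀ x : X, IsBasic x → ∃ d : ODir X, d.base = x

namespace ODir

variable {X : Type u} [PartialOrder X] [OrderBot X]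

/-- The direction `d'`, with `d'(w) = (z, y)` if `d(w) = (y, z)`. -/
def compl (d : ODir X) : ODir X where
  base := d.base
  basic := d.basic
  val w := (d.val w).swap
  principal := by
    intro y
    obtain ⟨hx, h₁, h₂, ⟨hl, hr, hc⟩, hg⟩ := d.principal y
    refine ⟨hx, h₂, h₁, ⟨hr, hl, ?_⟩, ?_⟩
    · rcases hc with h | h | ⟨h, x, hx', h'⟩
      · exact Or.inr (Or.inl h)
      · exact Or.inl h
      · refine Or.inr (Or.inr ⟨?_, x, ?_, h'⟩)
        · rw [Set.pair_comm]; exact h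
        · rw [Set.pair_comm]; exact hx'
    · rw [Set.pair_comm]; exact hg
  restrict y z hyz := ⟨(d.restrict y z hyz).2, (d.restrict y z hyz).1⟩
  join := by
    intro y z hy hz hdy hdz
    have e₁ : d.val z = (d.base, z.1) := by
      rw [← Prod.swap_swap (d.val z), hdz]; rfl
    have e₂ : d.val y = (y.1, d.base) := by
      rw [← Prod.swap_swap (d.val y), hdy]; rfl
    obtain ⟨u, hu, h₁, h₂⟩ := d.join z y hz hy e₁ e₂
    exact ⟨u, by rw [Set.pair_comm]; exact hu, h₂, h₁⟩

/-- The direction `0` for `⊥`, with `0(w) = (⊥, w)`. -/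
def zero : ODir X where
  base := ⊥
  basic := Or.inl rfl
  val w := (⊥, w.1)
  principal := by
    rintro ⟨y, hy⟩
    have hb : (⟨⊥, bot_le⟩ : Set.Iic y) = ⊥ := rfl
    have ht : (⟨y, le_rfl⟩ : Set.Iic y) = ⊤ := rfl
    refine ⟨bot_le, bot_le, le_rfl, ⟨?_, ?_, Or.inr (Or.inl ⟨rfl, Or.inl rfl⟩)⟩, ?_⟩
    · constructor
      · intro y z j m n _ hj hm hn
        change IsLUB {⊥, y} j at hj
        change IsLUB {⊥, n} m
        have : j = y := hj.unique ⟨by simp [upperBounds], fun a ha => ha (by simp)⟩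
        subst this
        obtain rfl := hm.unique hn
        exact ⟨by simp [upperBounds], fun a ha => ha (by simp)⟩
      · intro w y j m n hwy hj hm hn
        change IsLUB {w, ⊥} j at hj
        change IsGLB {⊥, y} n at hn
        have h1 : j = w := hj.unique ⟨by simp [upperBounds], fun a ha => ha (by simp)⟩
        subst h1
        have h2 : m = j := hm.unique ⟨by simp [lowerBounds, hwy], fun a ha => ha (by simp)⟩
        subst h2
        have h3 : n = ⊥ := hn.unique ⟨by simp [lowerBounds], fun a ha => ha (by simp)⟩
        subst h3
        exact ⟨by simp [upperBounds], fun a ha => ha (by simp)⟩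
    · constructor
      · intro y' z j m n hz hj hm hn
        change (⊤ : Set.Iic y) ≤ z at hz
        change IsLUB {⊤, y'} j at hj
        change IsLUB {⊤, n} m
        obtain rfl := top_le_iff.1 hz
        have h1 : j = ⊤ := top_le_iff.1 (hj.1 (by simp))
        subst h1
        have h2 : m = ⊤ := hm.unique ⟨by simp [lowerBounds], fun a ha => ha (by simp)⟩
        subst h2
        exact ⟨by simp [upperBounds], fun a ha => ha (by simp)⟩
      · intro w y' j m n hwy hj hm hn
        change IsLUB {w, ⊤} j at hj
        change IsGLB {⊤, y'} n at hn
        have h1 : j = ⊤ := top_le_iff.1 (hj.1 (by simp))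
        subst h1
        obtain rfl := hm.unique hn
        have h2 : m = y' := hm.unique ⟨by simp [lowerBounds], fun a ha => ha (by simp)⟩
        subst h2
        exact ⟨by simp [upperBounds, hwy], fun a ha => ha (by simp)⟩
    · change IsGLB {(⊥ : Set.Iic y), ⊤} ⊥
      exact ⟨by simp [lowerBounds], fun a ha => ha (by simp)⟩
  restrict y z hyz := by
    refine ⟨⟨by simp [lowerBounds], fun a ha => ha (by simp)⟩,
      ⟨?_, fun a ha => ha (by simp)⟩⟩
    have : y.1 ≤ z.1 := hyz
    simp [lowerBounds, this]
  join := by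
    intro y z _ hz _ h
    exact absurd (Prod.ext_iff.1 h).1 (ne_of_lt hz.lt)

/-- The direction `1` for `⊥`, with `1(w) = (w, ⊥)`. -/
def one : ODir X := compl zero

/-- The two atoms are near: they are distinct and have a join `w` that covers both. -/
def NearWithJoin (x y w : X) : Prop :=
  IsAtom x ∧ IsAtom y ∧ x ≠ y ∧ IsLUB {x, y} w ∧ x ⋖ w ∧ y ⋖ w

/-- The graph of the partial operation `⊕` on directions: `d ⊕ 0 = d = 0 ⊕ d`, `d ⊕ d' = 1`, and if
`d`, `e` are directions for near atoms `x`, `y` with join `w`, third atom `z` below `w`, and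
`d(w) = (x, w)`, `e(w) = (y, w)`, then `d ⊕ e` is the direction `f` for `z` with
`f(w) = (w, z)`. -/
def sum (d e f : ODir X) : Prop :=
  (e = zero ∧ f = d) ∨ (d = zero ∧ f = e) ∨ (e = d.compl ∧ f = one) ∨
    ∃ (w : X) (hd : d.base ≤ w) (he : e.base ≤ w) (hf : f.base ≤ w),
      NearWithJoin d.base e.base w ∧
      IsAtom f.base ∧ f.base ≠ d.base ∧ f.base ≠ e.base ∧
      d.val ⟨w, hd⟩ = (d.base, w) ∧ e.val ⟨w, he⟩ = (e.base, w) ∧ f.val ⟨w, hf⟩ = (w, f.base)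

instance orthoData : OrthoData (ODir X) where
  ozero := zero
  oone := one
  ocompl := compl
  osum := sum

end ODir

/-! ### Principal subalgebras of a Boolean algebra -/

/-! The lattice of subalgebras of a Boolean algebra `B` remembers `B` up to confusing `p` with `pᶜ`:
its basic elements are the `gen p`, and the principal pairs for `gen p` are exactly (`principal p`,
`principal pᶜ`) and its swap (`isPrincipalPairFor_gen_iff`). A value of a direction is therefore a
choice between `p` and `pᶜ`. A chart at `w` identifies the down-set of `w` with the subalgebras of
some `B`. In a short orthodomain a direction is determined by any value strictly above its base
(`ODir.eq_of_val_eq`), so if there are enough directions and `w` is not basic, the directions with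
base below `w` correspond to the elements of `B`, and `⊕` becomes the join of disjoint elements
(`Chart.sum_iff`).

From 1 to 2, the laws of `Dir(X)` are verified inside single charts. Only associativity needs an
argument that the directions involved share a chart: condition (iii) on directions provides it
(`ODir.exists_of_sum_sum`). Sending `w` to the set of directions with base below `w` embeds `X` as a
down-set of Boolean subalgebras. Every Boolean subalgebra of height at most 3 is reached: its unit
splits into at most four pieces that cannot be cut further, three of them form an iterated sum, so
they lie below one `w`, and the rest follows by complement and joins.

From 2 to 1, an element `a` of `A` orients all Boolean subalgebras containing it coherently, because
the order of each is expressible by sums in `A`. For condition (iii), with `a` unsplittable in `y`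
and `a'` unsplittable in `z`, the interval below `a'` in `y` is pasted to the interval below `a` in
`z` (`IsOrthoalgebra.exists_paste`). Each has at most four elements, so the result has at most 16,
hence height at most 3, and is in `X`. The same bound of 16, for a subalgebra generated by two
elements, transfers properness. -/

theorem isDualModular_iff {L : Type*} [Lattice L] {x : L} :
    IsDualModular x ↔ (∀ y z, x ≤ z → (x ⊔ y) ⊓ z = x ⊔ (y ⊓ z)) ∧
      ∀ w y, w ≤ y → (w ⊔ x) ⊓ y = w ⊔ (x ⊓ y) := by
  constructor
  · intro h
    exact ⟨fun y z hz => (h.left y z _ _ _ hz isLUB_pair isGLB_pair isGLB_pair).unique isLUB_pair,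
      fun w y hy => (h.right w y _ _ _ hy isLUB_pair isGLB_pair isGLB_pair).unique isLUB_pair⟩
  · rintro ⟨h₁, h₂⟩
    constructor
    · intro y z j m n hz hj hm hn
      rw [hj.unique isLUB_pair] at hm
      rw [hm.unique isGLB_pair, hn.unique isGLB_pair, h₁ y z hz]
      exact isLUB_pair
    · intro w y j m n hz hj hm hn
      rw [hj.unique isLUB_pair] at hm
      rw [hm.unique isGLB_pair, hn.unique isGLB_pair, h₂ w y hz]
      exact isLUB_pair

namespace BooleanSubalgebra

variable {B : Type*} [BooleanAlgebra B]

/-- The subalgebra generated by one element. -/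
def gen (p : B) : BooleanSubalgebra B where
  carrier := {c | c = ⊥ ∨ c = p ∨ c = pᶜ ∨ c = ⊤}
  supClosed' := by
    rintro a (rfl | rfl | rfl | rfl) b (rfl | rfl | rfl | rfl) <;> simp
  infClosed' := by
    rintro a (rfl | rfl | rfl | rfl) b (rfl | rfl | rfl | rfl) <;> simp
  compl_mem' := by
    rintro a (rfl | rfl | rfl | rfl) <;> simp
  bot_mem' := Or.inl rfl

theorem mem_gen {p c : B} : c ∈ gen p ↔ c = ⊥ ∨ c = p ∨ c = pᶜ ∨ c = ⊤ := Iff.rfl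

theorem self_mem_gen (p : B) : p ∈ gen p := Or.inr (Or.inl rfl)

theorem gen_le {p : B} {S : BooleanSubalgebra B} : gen p ≤ S ↔ p ∈ S := by
  constructor
  · exact fun h => h (self_mem_gen p)
  · rintro h c (rfl | rfl | rfl | rfl)
    · exact bot_mem
    · exact h
    · exact compl_mem h
    · exact top_mem

theorem gen_eq_bot {p : B} : gen p = ⊥ ↔ p = ⊥ ∨ p = ⊤ := by
  rw [← le_bot_iff, gen_le, mem_bot]

theorem gen_compl (p : B) : gen pᶜ = gen p :=
  le_antisymm (gen_le.2 (compl_mem (self_mem_gen p)))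
    (gen_le.2 (by simpa using compl_mem (self_mem_gen pᶜ)))

theorem gen_eq_gen {p q : B} : gen p = gen q ↔ p = q ∨ p = qᶜ := by
  constructor
  · intro h
    have h1 : p ∈ gen q := h ▸ self_mem_gen p
    have h2 : q ∈ gen p := h ▸ self_mem_gen q
    rcases mem_gen.1 h1 with rfl | h1 | h1 | rfl
    · rcases mem_gen.1 h2 with rfl | rfl | rfl | rfl <;> simp
    · exact Or.inl h1
    · exact Or.inr h1
    · rcases mem_gen.1 h2 with rfl | rfl | rfl | rfl <;> simp
  · rintro (rfl | rfl)
    · rfl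
    · exact gen_compl q

theorem isBasic_iff {S : BooleanSubalgebra B} : IsBasic S ↔ ∃ p, S = gen p := by
  constructor
  · rintro (rfl | h)
    · exact ⟨⊥, (gen_eq_bot.2 (Or.inl rfl)).symm⟩
    · have : ∃ p ∈ S, p ∉ (⊥ : BooleanSubalgebra B) := by
        by_contra! hc
        exact h.1 (le_bot_iff.1 hc)
      obtain ⟨p, hp, hp'⟩ := this
      refine ⟨p, ?_⟩
      rcases h.le_iff.1 (gen_le.2 hp) with h' | h'
      · exact absurd (h' ▸ self_mem_gen p) hp'
      · exact h'.symm
  · rintro ⟨p, rfl⟩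
    by_cases h0 : p = ⊥ ∨ p = ⊤
    · exact Or.inl (gen_eq_bot.2 h0)
    · refine Or.inr ⟨fun h => h0 (gen_eq_bot.1 h), fun D hD => ?_⟩
      have hp : p ∉ D := fun h => hD.not_ge (gen_le.2 h)
      rw [← le_bot_iff]
      intro c hc
      rcases hD.le hc with rfl | rfl | rfl | rfl
      · exact bot_mem
      · exact absurd hc hp
      · exact absurd (by simpa using compl_mem hc) hp
      · exact top_mem

theorem isAtom_gen {p : B} (h0 : p ≠ ⊥) (h1 : p ≠ ⊤) : IsAtom (gen p) :=
  (isBasic_iff.2 ⟨p, rfl⟩).resolve_left fun h => by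
    rcases gen_eq_bot.1 h with h | h <;> contradiction

/-- The subalgebra consisting of the elements below `p` and the elements above `pᶜ`. -/
def principal (p : B) : BooleanSubalgebra B where
  carrier := {c | c ≤ p ∨ pᶜ ≤ c}
  supClosed' := by
    rintro a (ha | ha) b (hb | hb)
    · exact Or.inl (sup_le ha hb)
    · exact Or.inr (le_sup_of_le_right hb)
    · exact Or.inr (le_sup_of_le_left ha)
    · exact Or.inr (le_sup_of_le_left ha)
  infClosed' := by
    rintro a (ha | ha) b (hb | hb)
    · exact Or.inl (inf_le_of_left_le ha)
    · exact Or.inl (inf_le_of_left_le ha)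
    · exact Or.inl (inf_le_of_right_le hb)
    · exact Or.inr (le_inf ha hb)
  compl_mem' := by
    rintro a (ha | ha)
    · exact Or.inr (compl_le_compl ha)
    · exact Or.inl (compl_le_of_compl_le ha)
  bot_mem' := Or.inl bot_le

theorem mem_principal {p c : B} : c ∈ principal p ↔ c ≤ p ∨ pᶜ ≤ c := Iff.rfl

theorem mem_principal_compl {p c : B} : c ∈ principal pᶜ ↔ c ≤ pᶜ ∨ p ≤ c := by
  rw [mem_principal, compl_compl]

theorem self_mem_principal (p : B) : p ∈ principal p := Or.inl le_rfl

theorem principal_le {p : B} {S : BooleanSubalgebra B} : principal p ≤ S ↔ ∀ c ≤ p, c ∈ S := by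
  constructor
  · exact fun h c hc => h (Or.inl hc)
  · rintro h c (hc | hc)
    · exact h c hc
    · simpa using compl_mem (h cᶜ (compl_le_of_compl_le hc))

theorem principal_inf_principal_compl (p : B) : principal p ⊓ principal pᶜ = gen p := by
  apply le_antisymm
  · rintro c ⟨h1, h2⟩
    rcases h1 with h1 | h1 <;> rcases mem_principal_compl.1 h2 with h2 | h2
    · exact Or.inl (le_bot_iff.1 (inf_compl_eq_bot (a := p) ▸ le_inf h1 h2))
    · exact Or.inr (Or.inl (le_antisymm h1 h2))
    · exact Or.inr (Or.inr (Or.inl (le_antisymm h2 h1)))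
    · exact Or.inr (Or.inr (Or.inr (top_le_iff.1 (sup_compl_eq_top (x := p) ▸ sup_le h2 h1))))
  · exact gen_le.2 ⟨Or.inl le_rfl, mem_principal_compl.2 (Or.inr le_rfl)⟩

theorem principal_sup_principal_compl (p : B) : principal p ⊔ principal pᶜ = ⊤ := by
  rw [← top_le_iff]
  intro c _
  have h1 : c ⊓ p ∈ principal p ⊔ principal pᶜ :=
    (le_sup_left : principal p ≤ _) (Or.inl inf_le_right)
  have h2 : c ⊓ pᶜ ∈ principal p ⊔ principal pᶜ :=
    (le_sup_right : principal pᶜ ≤ _) (Or.inl inf_le_right)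
  have := sup_mem h1 h2
  rwa [← inf_sup_left, sup_compl_eq_top, inf_top_eq] at this

/-- The elements that agree off `p` with some member of `S` form a subalgebra containing both `S`
and `principal p`. -/
theorem exists_mem_of_mem_sup_principal {p : B} {S : BooleanSubalgebra B} {c : B}
    (hc : c ∈ S ⊔ principal p) : ∃ s ∈ S, c ⊓ pᶜ = s ⊓ pᶜ := by
  let T : BooleanSubalgebra B :=
    { carrier := {c | ∃ s ∈ S, c ⊓ pᶜ = s ⊓ pᶜ}
      supClosed' := by
        rintro a ⟨s, hs, h⟩ b ⟨t, ht, h'⟩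
        exact ⟨s ⊔ t, sup_mem hs ht, by rw [inf_sup_right, inf_sup_right, h, h']⟩
      infClosed' := by
        rintro a ⟨s, hs, h⟩ b ⟨t, ht, h'⟩
        exact ⟨s ⊓ t, inf_mem hs ht, by rw [inf_inf_distrib_right, h, h', ← inf_inf_distrib_right]⟩
      compl_mem' := by
        rintro a ⟨s, hs, h⟩
        refine ⟨sᶜ, compl_mem hs, ?_⟩
        have h' : (a ⊓ pᶜ)ᶜ ⊓ pᶜ = (s ⊓ pᶜ)ᶜ ⊓ pᶜ := by rw [h]
        simpa [compl_inf, inf_sup_right] using h'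
      bot_mem' := ⟨⊥, bot_mem, rfl⟩ }
  have h : S ⊔ principal p ≤ T := by
    refine sup_le (fun c hc => ⟨c, hc, rfl⟩) (principal_le.2 fun c hc => ⟨⊥, bot_mem, ?_⟩)
    rw [bot_inf_eq, ← disjoint_iff]
    exact disjoint_compl_right.mono_left hc
  exact h hc

/-- An element of a join with `principal p` differs from a member of the other factor only below
`p`. That difference lies in `principal p`, so it can be removed and put back without leaving the
bounding subalgebra. -/
theorem isDualModular_principal (p : B) : IsDualModular (principal p) := by
  rw [isDualModular_iff]
  have key : ∀ c : B, ∀ S : BooleanSubalgebra B, principal p ≤ S → c ⊓ pᶜ ∈ S → c ∈ S := by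
    intro c S h hc
    have := sup_mem (h (Or.inl (inf_le_right : c ⊓ p ≤ p))) hc
    rwa [← inf_sup_left, sup_compl_eq_top, inf_top_eq] at this
  constructor
  · intro y z hz
    apply le_antisymm
    · rintro c ⟨hc, hcz⟩
      replace hc : c ∈ principal p ⊔ y := hc
      replace hcz : c ∈ z := hcz
      rw [sup_comm] at hc
      obtain ⟨s, hs, h⟩ := exists_mem_of_mem_sup_principal hc
      have hp : p ∈ principal p := Or.inl le_rfl
      have hsz : s ∈ z := key s z hz (h ▸ inf_mem hcz (compl_mem (hz hp)))
      refine key c _ le_sup_left ?_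
      rw [h]
      exact inf_mem ((le_sup_right : y ⊓ z ≤ _) ⟨hs, hsz⟩)
        ((le_sup_left : principal p ≤ _) (compl_mem hp))
    · exact sup_le (le_inf le_sup_left hz) (inf_le_inf_right _ le_sup_right)
  · intro w y hwy
    apply le_antisymm
    · rintro c ⟨hc, hcy⟩
      replace hc : c ∈ w ⊔ principal p := hc
      replace hcy : c ∈ y := hcy
      obtain ⟨s, hs, h⟩ := exists_mem_of_mem_sup_principal hc
      have hsy : s ∈ y := hwy hs
      have hle : ∀ a b : B, a ⊓ pᶜ = b ⊓ pᶜ → a \ b ≤ p := by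
        intro a b hab
        rw [sdiff_le_iff]
        calc a = a ⊓ p ⊔ a ⊓ pᶜ := by rw [← inf_sup_left, sup_compl_eq_top, inf_top_eq]
          _ ≤ b ⊔ p := by
            rw [hab]
            exact sup_le (le_sup_of_le_right inf_le_right) (le_sup_of_le_left inf_le_left)
      have h1 : c \ s ∈ w ⊔ principal p ⊓ y := (le_sup_right : principal p ⊓ y ≤ _)
        ⟨Or.inl (hle c s h), sdiff_mem hcy hsy⟩
      have h2 : s \ c ∈ w ⊔ principal p ⊓ y := (le_sup_right : principal p ⊓ y ≤ _)
        ⟨Or.inl (hle s c h.symm), sdiff_mem hsy hcy⟩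
      have h3 : s ∈ w ⊔ principal p ⊓ y := (le_sup_left : w ≤ _) hs
      have : c = s \ (s \ c) ⊔ c \ s := by
        rw [sdiff_sdiff_right_self, inf_comm, sup_inf_sdiff]
      rw [this]
      exact sup_mem (sdiff_mem h3 h2) h1
    · exact sup_le (le_inf le_sup_left hwy) (inf_le_inf_right _ le_sup_right)

/-- The elements whose part outside `a` lies in `S`. -/
def trace (S : BooleanSubalgebra B) (a : B) (ha : a ∈ S) : BooleanSubalgebra B where
  carrier := {d | d ⊓ aᶜ ∈ S}
  supClosed' := by
    intro d hd e he
    change (d ⊔ e) ⊓ aᶜ ∈ S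
    rw [inf_sup_right]; exact sup_mem hd he
  infClosed' := by
    intro d hd e he
    change (d ⊓ e) ⊓ aᶜ ∈ S
    rw [inf_inf_distrib_right]; exact inf_mem hd he
  compl_mem' := by
    intro d hd
    change dᶜ ⊓ aᶜ ∈ S
    have : d ⊓ aᶜ ∈ S := hd
    have h := inf_mem (compl_mem this) (compl_mem ha)
    rwa [compl_inf, inf_sup_right, compl_compl, inf_compl_eq_bot, sup_bot_eq] at h
  bot_mem' := by
    change ⊥ ⊓ aᶜ ∈ S
    rw [bot_inf_eq]; exact bot_mem

theorem mem_trace {S : BooleanSubalgebra B} {a : B} {ha : a ∈ S} {d : B} :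
    d ∈ trace S a ha ↔ d ⊓ aᶜ ∈ S := Iff.rfl

/-- Suppose `b ≤ a` and `c ≤ aᶜ` both lie outside `S`. Dual modularity then fails for `y = gen (b ⊔
c)` and `z = S ⊔ gen b`: members of `z` have their part outside `a` in `S`, so `y` and `z` meet
trivially, whereas `b = (b ⊔ c) ⊓ a` lies in `(S ⊔ y) ⊓ z` and not in `S`. -/
theorem principal_le_of_isDualModular {S : BooleanSubalgebra B} (hS : IsDualModular S) {a : B}
    (ha : a ∈ S) : principal a ≤ S ∨ principal aᶜ ≤ S := by
  rw [principal_le, principal_le]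
  by_contra! h
  obtain ⟨⟨b, hb, hbS⟩, c, hc, hcS⟩ := h
  have hca : c ⊓ a = ⊥ := disjoint_iff.1 (disjoint_compl_left.mono_left hc)
  have hba : b ⊓ aᶜ = ⊥ := disjoint_iff.1 (disjoint_compl_right.mono_left hb)
  have e1 : (b ⊔ c) ⊓ aᶜ = c := by rw [inf_sup_right, hba, bot_sup_eq, inf_eq_left.2 hc]
  have e2 : (b ⊔ c) ⊓ a = b := by rw [inf_sup_right, hca, sup_bot_eq, inf_eq_left.2 hb]
  have hz : S ⊔ gen b ≤ trace S a ha := by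
    refine sup_le (fun d hd => ?_) (gen_le.2 ?_)
    · exact mem_trace.2 (inf_mem hd (compl_mem ha))
    · rw [mem_trace, hba]; exact bot_mem
  have hbc : b ⊔ c ∉ S ⊔ gen b := fun h => hcS (by
    have := mem_trace.1 (hz h)
    rwa [e1] at this)
  have hm := (isDualModular_iff.1 hS).1 (gen (b ⊔ c)) (S ⊔ gen b) le_sup_left
  have hbot : gen (b ⊔ c) ⊓ (S ⊔ gen b) = ⊥ := by
    rw [← le_bot_iff]
    rintro d ⟨hd, hd'⟩
    replace hd' : d ∈ S ⊔ gen b := hd'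
    rcases mem_gen.1 hd with hd | hd | hd | hd
    · exact Or.inl hd
    · exact absurd (hd ▸ hd') hbc
    · refine absurd ?_ hbc
      have h' := compl_mem hd'
      rwa [hd, compl_compl] at h'
    · exact Or.inr hd
  rw [hbot, sup_bot_eq] at hm
  apply hbS
  have hmem : b ∈ (S ⊔ gen (b ⊔ c)) ⊓ (S ⊔ gen b) := by
    refine ⟨?_, (le_sup_right : gen b ≤ _) (self_mem_gen b)⟩
    have := inf_mem ((le_sup_right : gen (b ⊔ c) ≤ S ⊔ gen (b ⊔ c)) (self_mem_gen _))
      ((le_sup_left : S ≤ S ⊔ gen (b ⊔ c)) ha)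
    rwa [e2] at this
  rwa [hm] at hmem

/-- The part of `b ∈ y` off `p` lies in both `y` and `z`, hence in `gen p`, so it is `⊥` or all of
`pᶜ`. -/
theorem eq_principal {p : B} {y z : BooleanSubalgebra B} (hy : principal p ≤ y)
    (hz : principal pᶜ ≤ z) (h : y ⊓ z = gen p) : y = principal p := by
  refine le_antisymm (fun b hb => ?_) hy
  have hp : pᶜ ∈ y := hy (compl_mem (self_mem_principal p))
  have hb' : b ⊓ pᶜ ∈ gen p := h ▸ ⟨inf_mem hb hp, hz (Or.inl inf_le_right)⟩
  have key : b ⊓ pᶜ = ⊥ ∨ b ⊓ pᶜ = pᶜ := by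
    rcases hb' with h | h | h | h
    · exact Or.inl h
    · have : p ≤ pᶜ := h.symm.le.trans inf_le_right
      have hp0 : p = ⊥ := by simpa [le_compl_self] using this
      exact Or.inl (h.trans hp0)
    · exact Or.inr h
    · refine Or.inr (le_antisymm inf_le_right ?_)
      rw [h]; exact le_top
  rcases key with h | h
  · exact Or.inl (by rw [← compl_compl p, le_compl_iff_disjoint_right, disjoint_iff, h])
  · exact Or.inr (inf_eq_right.1 h)

/-- The degenerate case: `p` is `⊥` or an atom of `B`, so every element is disjoint from `p` or
above it. -/
theorem principal_eq_gen {p : B} (h : principal p ≤ gen p) :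
    principal p = gen p ∧ principal pᶜ = ⊤ := by
  refine ⟨le_antisymm h (gen_le.2 (self_mem_principal p)), top_le_iff.1 fun c _ => ?_⟩
  rw [mem_principal_compl]
  rcases h (Or.inl (inf_le_right : c ⊓ p ≤ p)) with h | h | h | h
  · exact Or.inl (by rw [le_compl_iff_disjoint_right, disjoint_iff, h])
  · exact Or.inr (inf_eq_right.1 h)
  · have h' : pᶜ ≤ p := h ▸ inf_le_right
    have : p = ⊤ := by simpa [compl_le_self] using h'
    subst this
    simp at h
    left; simp [h]
  · exact Or.inr (by
      have : c = ⊤ := top_le_iff.1 (h ▸ inf_le_left)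
      rw [this]; exact le_top)

/-- Each component is dual modular and contains `p`, so it contains `principal p` or `principal pᶜ`.
The first two clauses of a principal pair serve the degenerate case in which `gen p` is itself dual
modular and one component is `⊤`; the third serves all other `p`. -/
theorem isPrincipalPairFor_gen_iff {p : B} {y z : BooleanSubalgebra B} :
    IsPrincipalPairFor (gen p) y z ↔ (y = principal p ∧ z = principal pᶜ) ∨
      (y = principal pᶜ ∧ z = principal p) := by
  constructor
  · rintro ⟨⟨hy, hz, h⟩, hg⟩
    have hg' : y ⊓ z = gen p := isGLB_pair.unique hg
    have dm : IsDualModular (gen p) → (principal p = gen p ∧ principal pᶜ = ⊤) ∨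
        (principal pᶜ = gen p ∧ principal p = ⊤) := by
      intro hd
      rcases principal_le_of_isDualModular hd (self_mem_gen p) with h | h
      · exact Or.inl (principal_eq_gen h)
      · rw [← gen_compl] at h ⊢
        right
        simpa using principal_eq_gen h
    rcases h with ⟨rfl, hzb⟩ | ⟨rfl, hyb⟩ | ⟨h, x, hx, hxb, hxd⟩
    · rw [top_inf_eq] at hg'
      subst hg'
      rcases dm hz with ⟨h1, h2⟩ | ⟨h1, h2⟩
      · exact Or.inr ⟨h2.symm, h1.symm⟩
      · exact Or.inl ⟨h2.symm, h1.symm⟩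
    · rw [inf_top_eq] at hg'
      subst hg'
      rcases dm hy with ⟨h1, h2⟩ | ⟨h1, h2⟩
      · exact Or.inl ⟨h1.symm, h2.symm⟩
      · exact Or.inr ⟨h1.symm, h2.symm⟩
    · obtain rfl := hx.unique hg
      have hpy : p ∈ y := (hg'.symm.le.trans inf_le_left) (self_mem_gen p)
      have hpz : p ∈ z := (hg'.symm.le.trans inf_le_right) (self_mem_gen p)
      -- The components cannot both contain the same `principal q`: their meet `gen p` would equal
      -- it and so be dual modular, which the third clause forbids.
      have no : ∀ q, gen q = gen p → principal q ≤ y → principal q ≤ z → False := by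
        intro q hq h1 h2
        apply hxd
        rw [← hq, ← (principal_eq_gen ((le_inf h1 h2).trans (hg'.trans hq.symm).le)).1]
        exact isDualModular_principal q
      rcases principal_le_of_isDualModular hy hpy with h1 | h1 <;>
        rcases principal_le_of_isDualModular hz hpz with h2 | h2
      · exact (no p rfl h1 h2).elim
      · refine Or.inl ⟨eq_principal h1 h2 hg', eq_principal (z := y) h2 ?_ ?_⟩
        · rwa [compl_compl]
        · rw [inf_comm, gen_compl, hg']
      · refine Or.inr ⟨eq_principal (z := z) h1 ?_ ?_, eq_principal h2 h1 ?_⟩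
        · rwa [compl_compl]
        · rw [gen_compl, hg']
        · rw [inf_comm, hg']
      · exact (no pᶜ (gen_compl p) h1 h2).elim
  · have main : ∀ q : B, IsPrincipalPairFor (gen q) (principal q) (principal qᶜ) := by
      intro q
      have hg : IsGLB {principal q, principal qᶜ} (gen q) := by
        rw [← principal_inf_principal_compl]; exact isGLB_pair
      refine ⟨⟨isDualModular_principal _, isDualModular_principal _, ?_⟩, hg⟩
      by_cases hd : IsDualModular (gen q)
      · rcases principal_le_of_isDualModular hd (self_mem_gen q) with h | h
        · obtain ⟨h1, h2⟩ := principal_eq_gen h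
          exact Or.inr (Or.inl ⟨h2, isBasic_iff.2 ⟨q, h1⟩⟩)
        · rw [← gen_compl] at h
          obtain ⟨h1, h2⟩ := principal_eq_gen h
          rw [compl_compl] at h2
          exact Or.inl ⟨h2, isBasic_iff.2 ⟨_, h1⟩⟩
      · refine Or.inr (Or.inr ⟨?_, _, hg, isBasic_iff.2 ⟨q, rfl⟩, hd⟩)
        rw [← principal_sup_principal_compl q]; exact isLUB_pair
    rintro (⟨rfl, rfl⟩ | ⟨rfl, rfl⟩)
    · exact main p
    · have := main pᶜ
      rwa [gen_compl, compl_compl] at this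

/-- If `gen p` is everything, both principal subalgebras can be `⊤`, and `p` is then
indistinguishable from `pᶜ`. This is why charts are later taken at elements that are not basic. -/
theorem principal_injective {p q : B} (hp : gen p ≠ ⊤) (h₁ : principal p = principal q)
    (h₂ : principal pᶜ = principal qᶜ) : p = q := by
  have h : gen p = gen q := by
    rw [← principal_inf_principal_compl, h₁, h₂, principal_inf_principal_compl]
  rcases gen_eq_gen.1 h with h | rfl
  · exact h
  · refine absurd ?_ hp
    rw [compl_compl] at h₂
    rw [← principal_inf_principal_compl, compl_compl, h₂, inf_idem,
      ← principal_sup_principal_compl q, h₂, sup_idem]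

end BooleanSubalgebra

/-! ### Charts: the down-set of an element as a lattice of Boolean subalgebras -/

section Transport

variable {L L' : Type*} [PartialOrder L] [PartialOrder L'] (e : L ≃o L')

theorem OrderIso.isLUB_pair_iff {a b c : L} : IsLUB {e a, e b} (e c) ↔ IsLUB {a, b} c := by
  rw [← Set.image_pair, e.isLUB_image']

theorem OrderIso.isGLB_pair_iff {a b c : L} : IsGLB {e a, e b} (e c) ↔ IsGLB {a, b} c := by
  rw [← Set.image_pair, e.isGLB_image']

theorem IsDualModular.map {x : L} (h : IsDualModular x) : IsDualModular (e x) := by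
  constructor
  · intro y z j m n hz hj hm hn
    obtain ⟨y, rfl⟩ := e.surjective y
    obtain ⟨z, rfl⟩ := e.surjective z
    obtain ⟨j, rfl⟩ := e.surjective j
    obtain ⟨m, rfl⟩ := e.surjective m
    obtain ⟨n, rfl⟩ := e.surjective n
    rw [e.isLUB_pair_iff] at hj ⊢
    rw [e.isGLB_pair_iff] at hm hn
    exact h.left y z j m n (e.le_iff_le.1 hz) hj hm hn
  · intro w y j m n hz hj hm hn
    obtain ⟨w, rfl⟩ := e.surjective w
    obtain ⟨y, rfl⟩ := e.surjective y
    obtain ⟨j, rfl⟩ := e.surjective j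
    obtain ⟨m, rfl⟩ := e.surjective m
    obtain ⟨n, rfl⟩ := e.surjective n
    rw [e.isLUB_pair_iff] at hj ⊢
    rw [e.isGLB_pair_iff] at hm hn
    exact h.right w y j m n (e.le_iff_le.1 hz) hj hm hn

theorem IsBasic.map [OrderBot L] [OrderBot L'] {x : L} (h : IsBasic x) : IsBasic (e x) := by
  rcases h with rfl | h
  · exact Or.inl e.map_bot
  · exact Or.inr ((e.isAtom_iff x).2 h)

theorem IsPrincipalPairFor.map [BoundedOrder L] [BoundedOrder L'] {x y z : L}
    (h : IsPrincipalPairFor x y z) : IsPrincipalPairFor (e x) (e y) (e z) := by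
  obtain ⟨⟨hy, hz, h⟩, hg⟩ := h
  refine ⟨⟨hy.map e, hz.map e, ?_⟩, e.isGLB_pair_iff.2 hg⟩
  rcases h with ⟨rfl, h⟩ | ⟨rfl, h⟩ | ⟨h, t, ht, htb, htd⟩
  · exact Or.inl ⟨e.map_top, h.map e⟩
  · exact Or.inr (Or.inl ⟨e.map_top, h.map e⟩)
  · refine Or.inr (Or.inr ⟨?_, e t, e.isGLB_pair_iff.2 ht, htb.map e, fun hd => htd ?_⟩)
    · rw [← e.map_top]; exact e.isLUB_pair_iff.2 h
    · simpa using hd.map e.symm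

end Transport

/-- An order isomorphism of the subalgebras of `B` with the down-set of `w`. -/
structure Chart {X : Type*} [PartialOrder X] (w : X) (B : Type*) [BooleanAlgebra B] where
  emb : BooleanSubalgebra B ↪o X
  le_iff : ∀ x, x ≤ w ↔ ∃ C, emb C = x

open BooleanSubalgebra

namespace Chart

variable {X : Type*} [PartialOrder X] {w : X} {B : Type*} [BooleanAlgebra B] (κ : Chart w B)

theorem emb_le (C : BooleanSubalgebra B) : κ.emb C ≤ w := (κ.le_iff _).2 ⟨C, rfl⟩

theorem emb_top : κ.emb ⊤ = w := by
  obtain ⟨C, hC⟩ := (κ.le_iff w).1 le_rfl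
  exact le_antisymm (κ.emb_le _) (hC.symm.le.trans (κ.emb.monotone le_top))

theorem exists_of_le {x : X} {C : BooleanSubalgebra B} (h : x ≤ κ.emb C) :
    ∃ D ≤ C, κ.emb D = x := by
  obtain ⟨D, rfl⟩ := (κ.le_iff x).1 (h.trans (κ.emb_le C))
  exact ⟨D, κ.emb.le_iff_le.1 h, rfl⟩

theorem isGLB (C D : BooleanSubalgebra B) : IsGLB {κ.emb C, κ.emb D} (κ.emb (C ⊓ D)) := by
  refine ⟨?_, fun x hx => ?_⟩
  · rintro _ (rfl | rfl)
    · exact κ.emb.monotone inf_le_left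
    · exact κ.emb.monotone inf_le_right
  · obtain ⟨E, hE, rfl⟩ := κ.exists_of_le (hx (Set.mem_insert _ _))
    exact κ.emb.monotone (le_inf hE (κ.emb.le_iff_le.1 (hx (Set.mem_insert_of_mem _ rfl))))

theorem emb_covBy {C D : BooleanSubalgebra B} : κ.emb C ⋖ κ.emb D ↔ C ⋖ D := by
  constructor
  · exact fun h => ⟨κ.emb.lt_iff_lt.1 h.1, fun E h1 h2 =>
      h.2 (κ.emb.lt_iff_lt.2 h1) (κ.emb.lt_iff_lt.2 h2)⟩
  · refine fun h => ⟨κ.emb.lt_iff_lt.2 h.1, fun x h1 h2 => ?_⟩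
    obtain ⟨E, _, rfl⟩ := κ.exists_of_le h2.le
    exact h.2 (κ.emb.lt_iff_lt.1 h1) (κ.emb.lt_iff_lt.1 h2)

/-- A chart as an order isomorphism. -/
noncomputable def orderIso : BooleanSubalgebra B ≃o Set.Iic w :=
  RelIso.ofSurjective
    (OrderEmbedding.ofMapLEIff (fun C => (⟨κ.emb C, κ.emb_le C⟩ : Set.Iic w))
      fun _ _ => κ.emb.le_iff_le)
    (by
      rintro ⟨x, hx⟩
      obtain ⟨C, hC⟩ := (κ.le_iff x).1 hx
      exact ⟨C, Subtype.ext hC⟩)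

variable [OrderBot X]

theorem emb_bot : κ.emb ⊥ = ⊥ := by
  obtain ⟨C, hC⟩ := (κ.le_iff ⊥).1 bot_le
  exact le_bot_iff.1 (hC ▸ κ.emb.monotone bot_le)

theorem isAtom_emb {C : BooleanSubalgebra B} : IsAtom (κ.emb C) ↔ IsAtom C := by
  rw [← bot_covBy_iff, ← bot_covBy_iff, ← κ.emb_bot, κ.emb_covBy]

theorem isBasic_emb {C : BooleanSubalgebra B} : IsBasic (κ.emb C) ↔ IsBasic C := by
  rw [IsBasic, IsBasic, κ.isAtom_emb, ← κ.emb_bot, κ.emb.injective.eq_iff]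

theorem exists_gen {x : X} (hx : IsBasic x) (hw : x ≤ w) : ∃ p, κ.emb (gen p) = x := by
  obtain ⟨C, rfl⟩ := (κ.le_iff x).1 hw
  obtain ⟨p, rfl⟩ := isBasic_iff.1 (κ.isBasic_emb.1 hx)
  exact ⟨p, rfl⟩

theorem isPrincipalPairBelow (p : B) : IsPrincipalPairBelow (κ.emb (gen p)) w
    (κ.emb (principal p), κ.emb (principal pᶜ)) :=
  ⟨κ.emb_le _, κ.emb_le _, κ.emb_le _,
    (isPrincipalPairFor_gen_iff.2 (Or.inl ⟨rfl, rfl⟩)).map κ.orderIso⟩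

theorem eq_or_eq_of_isPrincipalPairBelow {x : X} {p : B} {v : X × X} (hp : κ.emb (gen p) = x)
    (h : IsPrincipalPairBelow x w v) :
    v = (κ.emb (principal p), κ.emb (principal pᶜ)) ∨
      v = (κ.emb (principal pᶜ), κ.emb (principal p)) := by
  subst hp
  obtain ⟨v₁, v₂⟩ := v
  obtain ⟨hx, h₁, h₂, h⟩ := h
  obtain ⟨C, rfl⟩ := (κ.le_iff _).1 h₁
  obtain ⟨D, rfl⟩ := (κ.le_iff _).1 h₂
  have := h.map κ.orderIso.symm
  change IsPrincipalPairFor (κ.orderIso.symm (κ.orderIso _)) (κ.orderIso.symm (κ.orderIso _))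
    (κ.orderIso.symm (κ.orderIso _)) at this
  simp only [OrderIso.symm_apply_apply] at this
  rcases isPrincipalPairFor_gen_iff.1 this with ⟨rfl, rfl⟩ | ⟨rfl, rfl⟩
  · exact Or.inl rfl
  · exact Or.inr rfl

end Chart

theorem IsOrthodomain.exists_chart {X : Type u} [PartialOrder X] [OrderBot X]
    (hX : IsOrthodomain X) (w : X) :
    ∃ (B : Type u) (_ : BooleanAlgebra B), Nonempty (Chart w B) := by
  obtain ⟨B, hB, ⟨e⟩⟩ := hX.booleanDomain_Iic w
  refine ⟨B, hB, ⟨⟨OrderEmbedding.ofMapLEIff (fun C => (e.symm C).1) fun C D => ?_, fun x => ?_⟩⟩⟩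
  · exact e.symm.le_iff_le
  · constructor
    · exact fun hx => ⟨e ⟨x, hx⟩, by simp⟩
    · rintro ⟨C, rfl⟩
      exact (e.symm C).2

/-! ### A direction is determined by any of its nontrivial values -/

theorem IsShort.wellFoundedLT {X : Type u} [PartialOrder X] (h : IsShort X) :
    WellFoundedLT X :=
  StrictMono.wellFoundedLT (f := (Order.height : X → ℕ∞))
    fun x _ hxy => Order.height_strictMono hxy ((h x).trans_lt (by decide))

theorem IsShort.exists_covBy {X : Type u} [PartialOrder X] (h : IsShort X) {x w : X}
    (hxw : x < w) : ∃ v, x ⋖ v ∧ v ≤ w := by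
  have := h.wellFoundedLT
  exact exists_covBy_le_of_lt hxw

namespace ODir

variable {X : Type u} [PartialOrder X] [OrderBot X]

theorem ext_val {d e : ODir X} (hb : d.base = e.base)
    (h : ∀ w hd he, d.val ⟨w, hd⟩ = e.val ⟨w, he⟩) : d = e := by
  obtain ⟨b, _, v, _, _, _⟩ := d
  obtain ⟨b', _, v', _, _, _⟩ := e
  obtain rfl : b = b' := hb
  obtain rfl : v = v' := funext fun w => h w.1 w.2 w.2
  rfl

theorem compl_compl (d : ODir X) : d.compl.compl = d :=
  ext_val rfl fun _ _ _ => Prod.swap_swap _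

theorem val_eq_of_le {d e : ODir X} {v w : X} (hvw : v ≤ w) (hd : d.base ≤ v) (he : e.base ≤ v)
    (h : d.val ⟨w, hd.trans hvw⟩ = e.val ⟨w, he.trans hvw⟩) :
    d.val ⟨v, hd⟩ = e.val ⟨v, he⟩ := by
  have h1 := d.restrict ⟨v, hd⟩ ⟨w, hd.trans hvw⟩ hvw
  have h2 := e.restrict ⟨v, he⟩ ⟨w, he.trans hvw⟩ hvw
  rw [h] at h1
  exact Prod.ext (h1.1.unique h2.1) (h1.2.unique h2.2)

theorem val_covBy (d : ODir X) {v : X} (hv : d.base ⋖ v) :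
    d.val ⟨v, hv.le⟩ = (d.base, v) ∨ d.val ⟨v, hv.le⟩ = (v, d.base) := by
  obtain ⟨_, h₁, h₂, ⟨_, _, h⟩, hg⟩ := d.principal ⟨v, hv.le⟩
  generalize d.val ⟨v, hv.le⟩ = p at *
  obtain ⟨p, q⟩ := p
  have hp : d.base ≤ p := hg.1 (Set.mem_insert _ _)
  have hq : d.base ≤ q := hg.1 (Set.mem_insert_of_mem _ rfl)
  rcases hv.eq_or_eq hp h₁ with rfl | rfl <;> rcases hv.eq_or_eq hq h₂ with rfl | rfl
  · exfalso
    have ht : (⟨d.base, hv.le⟩ : Set.Iic v) ≠ ⊤ := fun h => hv.ne (congrArg Subtype.val h)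
    rcases h with ⟨h, _⟩ | ⟨h, _⟩ | ⟨h, _⟩
    · exact ht h
    · exact ht h
    · rw [Set.pair_eq_singleton] at h
      exact ht (isLUB_singleton.unique h)
  · exact Or.inl rfl
  · exact Or.inr rfl
  · rw [Set.pair_eq_singleton] at hg
    exact absurd (congrArg Subtype.val (hg.unique isGLB_singleton)) hv.ne

theorem val_eq_or_swap (hX : IsOrthodomain X) {d e : ODir X} (hb : d.base = e.base) {w : X}
    (hd : d.base ≤ w) (he : e.base ≤ w) :
    d.val ⟨w, hd⟩ = e.val ⟨w, he⟩ ∨ d.val ⟨w, hd⟩ = (e.val ⟨w, he⟩).swap := by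
  obtain ⟨B, _, ⟨κ⟩⟩ := hX.exists_chart w
  obtain ⟨p, hp⟩ := κ.exists_gen d.basic hd
  rcases κ.eq_or_eq_of_isPrincipalPairBelow hp (d.principal ⟨w, hd⟩) with h1 | h1 <;>
    rcases κ.eq_or_eq_of_isPrincipalPairBelow (hp.trans hb) (e.principal ⟨w, he⟩) with h2 | h2 <;>
      rw [h1, h2] <;> simp

/-- Otherwise the two values at `w` are swaps of each other; restricting to `v` would make the value
at a cover of the base equal to its own swap. -/
theorem val_eq_of_covBy_le (hX : IsOrthodomain X) {d e : ODir X} (hb : d.base = e.base) {v w : X}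
    (hd : d.base ⋖ v) (he : e.base ≤ v) (hvw : v ≤ w) (h : d.val ⟨v, hd.le⟩ = e.val ⟨v, he⟩) :
    d.val ⟨w, hd.le.trans hvw⟩ = e.val ⟨w, he.trans hvw⟩ := by
  rcases val_eq_or_swap hX hb (hd.le.trans hvw) (he.trans hvw) with h' | h'
  · exact h'
  · exfalso
    have h2 := val_eq_of_le (e := e.compl) hvw hd.le he h'
    have h3 : (e.val ⟨v, he⟩).swap = e.val ⟨v, he⟩ := h2.symm.trans h
    rw [← h] at h3
    rcases d.val_covBy hd with h4 | h4 <;> rw [h4] at h3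
    · exact hd.ne (Prod.ext_iff.1 h3).2
    · exact hd.ne (Prod.ext_iff.1 h3).1

/-- Suppose `d` and `e` agree at a cover `w₀` of the base but are opposite at a cover `v₀`. Then one
of them is oriented oppositely at `w₀` and `v₀`, so condition (iii) yields `u` above both; agreement
passes from `w₀` up to `u` and down to `v₀`. -/
theorem eq_of_val_eq (hX : IsOrthodomain X) (hs : IsShort X) {d e : ODir X}
    (hb : d.base = e.base) {w : X} (hd : d.base < w) (he : e.base ≤ w)
    (h : d.val ⟨w, hd.le⟩ = e.val ⟨w, he⟩) : d = e := by
  refine ext_val hb fun v hdv hev => ?_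
  rcases hdv.eq_or_lt with rfl | hlt
  -- At the base itself both components are forced to be the base.
  · obtain ⟨_, h₁, h₂, _, hg⟩ := d.principal ⟨d.base, le_rfl⟩
    obtain ⟨_, h₁', h₂', _, hg'⟩ := e.principal ⟨d.base, hev⟩
    have g₁ := hg.1 (Set.mem_insert _ _)
    have g₂ := hg.1 (Set.mem_insert_of_mem _ rfl)
    have g₁' := hg'.1 (Set.mem_insert _ _)
    have g₂' := hg'.1 (Set.mem_insert_of_mem _ rfl)
    simp only [← hb] at g₁ g₂ g₁' g₂'
    exact Prod.ext ((le_antisymm h₁ g₁).trans (le_antisymm g₁' h₁'))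
      ((le_antisymm h₂ g₂).trans (le_antisymm g₂' h₂'))
  · obtain ⟨w₀, hw₀, hw⟩ := hs.exists_covBy hd
    obtain ⟨v₀, hv₀, hv⟩ := hs.exists_covBy hlt
    have ew₀ : e.base ⋖ w₀ := hb ▸ hw₀
    have ev₀ : e.base ⋖ v₀ := hb ▸ hv₀
    have aw := val_eq_of_le hw hw₀.le ew₀.le h
    refine val_eq_of_covBy_le hX hb hv₀ ev₀.le hv ?_
    rcases val_eq_or_swap hX hb hv₀.le ev₀.le with h' | h'
    · exact h'
    · have main : ∀ u, w₀ ≤ u → v₀ ≤ u → d.val ⟨v₀, hv₀.le⟩ = e.val ⟨v₀, ev₀.le⟩ :=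
        fun u h1 h2 => val_eq_of_le h2 hv₀.le ev₀.le
          (val_eq_of_covBy_le hX hb hw₀ ew₀.le h1 aw)
      have swap_eq : e.val ⟨v₀, ev₀.le⟩ = (d.val ⟨v₀, hv₀.le⟩).swap := by
        rw [h', Prod.swap_swap]
      rcases d.val_covBy hw₀ with hw₁ | hw₁ <;> rcases d.val_covBy hv₀ with hv₁ | hv₁
      · obtain ⟨u, _, h1, h2⟩ := e.join ⟨w₀, ew₀.le⟩ ⟨v₀, ev₀.le⟩ ew₀ ev₀
          (by rw [← aw, hw₁, hb]) (by rw [swap_eq, hv₁, hb]; rfl)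
        exact main u h1.le h2.le
      · obtain ⟨u, _, h1, h2⟩ := d.join ⟨w₀, hw₀.le⟩ ⟨v₀, hv₀.le⟩ hw₀ hv₀ hw₁ hv₁
        exact main u h1.le h2.le
      · obtain ⟨u, _, h1, h2⟩ := d.join ⟨v₀, hv₀.le⟩ ⟨w₀, hw₀.le⟩ hv₀ hw₀ hv₁ hw₁
        exact main u h2.le h1.le
      · obtain ⟨u, _, h1, h2⟩ := e.join ⟨v₀, ev₀.le⟩ ⟨w₀, ew₀.le⟩ ev₀ ew₀
          (by rw [swap_eq, hv₁, hb]; rfl) (by rw [← aw, hw₁, hb])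
        exact main u h2.le h1.le

end ODir

theorem HasEnoughDirections.exists_not_isBasic {X : Type u} [PartialOrder X] [OrderBot X]
    (h : HasEnoughDirections X) (x : X) : ∃ w, x ≤ w ∧ ¬ IsBasic w := by
  by_cases hx : IsBasic x
  · obtain ⟨y, hxy⟩ := not_isMax_iff.1 fun hm => h.1 x hm hx
    by_cases hy : IsBasic y
    · obtain ⟨z, hyz⟩ := not_isMax_iff.1 fun hm => h.1 y hm hy
      refine ⟨z, (hxy.trans hyz).le, ?_⟩
      rintro (rfl | hz)
      · exact not_lt_bot hyz
      · exact not_lt_bot (hz.2 y hyz ▸ hxy)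
    · exact ⟨y, hxy.le, hy⟩
  · exact ⟨x, le_rfl, hx⟩

/-! ### Sums of directions in a chart -/

namespace BooleanSubalgebra

variable {B : Type*} [BooleanAlgebra B]

theorem principal_bot : principal (⊥ : B) = ⊥ := by
  refine BooleanSubalgebra.ext fun c => ?_
  rw [mem_principal, mem_bot, le_bot_iff, compl_bot, top_le_iff]

theorem principal_top : principal (⊤ : B) = ⊤ :=
  top_le_iff.1 fun _ _ => Or.inl le_top

theorem sup_gen_le_principal_sup (p q : B) : gen p ⊔ gen q ≤ principal (p ⊔ q) :=
  sup_le (gen_le.2 (Or.inl le_sup_left)) (gen_le.2 (Or.inl le_sup_right))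

/-- The inclusions say that `p`, `q` and `rᶜ` are unsplittable in `gen p ⊔ gen q`: each of its
members contains them or is disjoint from them. Unsplittable elements generating different
subalgebras are disjoint, whence `p ⊔ q ≤ r`; and `r`, not being `⊤`, cannot also contain `(p ⊔
q)ᶜ`. -/
theorem disjoint_and_sup_eq {p q r : B} (hp : gen p ⊔ gen q ≤ principal pᶜ)
    (hq : gen p ⊔ gen q ≤ principal qᶜ) (hr : gen p ⊔ gen q ≤ principal r)
    (hrm : r ∈ gen p ⊔ gen q) (hr1 : r ≠ ⊤) (hpq : gen p ≠ gen q)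
    (hrp : gen r ≠ gen p) (hrq : gen r ≠ gen q) : Disjoint p q ∧ p ⊔ q = r := by
  have hpm : p ∈ gen p ⊔ gen q := (le_sup_left : gen p ≤ _) (self_mem_gen p)
  have hqm : q ∈ gen p ⊔ gen q := (le_sup_right : gen q ≤ _) (self_mem_gen q)
  have hdisj : Disjoint p q := by
    rcases mem_principal_compl.1 (hp hqm) with h | h
    · exact (le_compl_iff_disjoint_right.1 h).symm
    · rcases mem_principal_compl.1 (hq hpm) with h' | h'
      · exact le_compl_iff_disjoint_right.1 h'
      · exact absurd (by rw [le_antisymm h h']) hpq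
  have aux : ∀ s ∈ gen p ⊔ gen q, gen p ⊔ gen q ≤ principal sᶜ → gen r ≠ gen s → s ≤ r := by
    intro s hs hs' hne
    rcases hr hs with h | h
    · exact h
    · rcases mem_principal_compl.1 (hs' (compl_mem hrm)) with h' | h'
      · have : rᶜ ≤ ⊥ := inf_compl_eq_bot (a := s) ▸ le_inf h h'
        exact absurd (compl_eq_bot.1 (le_bot_iff.1 this)) hr1
      · exact absurd (by rw [← le_antisymm h h', gen_compl]) hne
  have hle : p ⊔ q ≤ r := sup_le (aux p hpm hp hrp) (aux q hqm hq hrq)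
  refine ⟨hdisj, ?_⟩
  rcases sup_gen_le_principal_sup p q hrm with h | h
  · exact le_antisymm hle h
  · have : (⊤ : B) ≤ r := by
      rw [← sup_compl_eq_top (x := p ⊔ q)]; exact sup_le hle h
    exact absurd (top_le_iff.1 this) hr1

theorem sup_gen_le_principal_compl {p q : B} (h : Disjoint p q) :
    gen p ⊔ gen q ≤ principal pᶜ :=
  sup_le (gen_le.2 (mem_principal_compl.2 (Or.inr le_rfl)))
    (gen_le.2 (mem_principal_compl.2 (Or.inl (le_compl_iff_disjoint_left.2 h))))

/-- Let `g` be a member of an intermediate subalgebra outside `gen p`, complemented if necessary so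
that `q ≤ g`. It cannot contain `(p ⊔ q)ᶜ`, or it would contain `pᶜ` and lie in `gen p`; so it lies
below `p ⊔ q`, and `q = g ⊓ pᶜ` is recovered from it. -/
theorem gen_covBy_sup {p q : B} (h : Disjoint p q) (hq : q ≠ ⊥) (hpq : p ⊔ q ≠ ⊤) :
    gen p ⋖ gen p ⊔ gen q := by
  have hqp : q ≤ pᶜ := le_compl_iff_disjoint_left.2 h
  constructor
  · refine lt_of_le_of_ne le_sup_left fun he => ?_
    have : q ∈ gen p := by rw [he]; exact (le_sup_right : gen q ≤ _) (self_mem_gen q)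
    rcases this with rfl | rfl | rfl | rfl
    · exact hq rfl
    · exact hq (disjoint_self.1 h)
    · exact hpq sup_compl_eq_top
    · exact hpq (by simp)
  · intro D h1 h2
    refine h2.not_ge (sup_le h1.le (gen_le.2 ?_))
    have hpD : p ∈ D := gen_le.1 h1.le
    have : ∃ g ∈ D, g ∉ gen p := by
      by_contra! hc
      exact h1.not_ge hc
    obtain ⟨g, hg, hgp⟩ := this
    have hqc : gen p ⊔ gen q ≤ principal qᶜ := by
      rw [sup_comm]; exact sup_gen_le_principal_compl h.symm
    have key : ∀ g ∈ D, g ∉ gen p → q ≤ g → q ∈ D := by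
      intro g hg hgp hqg
      rcases sup_gen_le_principal_sup p q (h2.le hg) with h' | h'
      · have : q = g ⊓ pᶜ := le_antisymm (le_inf hqg hqp) <| by
          calc g ⊓ pᶜ ≤ (p ⊔ q) ⊓ pᶜ := inf_le_inf_right _ h'
            _ ≤ q := by rw [inf_sup_right, inf_compl_eq_bot, bot_sup_eq]; exact inf_le_left
        rw [this]
        exact inf_mem hg (compl_mem hpD)
      · exfalso
        apply hgp
        have hpg : pᶜ ≤ g := by
          calc pᶜ = pᶜ ⊓ ((p ⊔ q) ⊔ (p ⊔ q)ᶜ) := by rw [sup_compl_eq_top, inf_top_eq]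
            _ ≤ g := by
              rw [inf_sup_left, inf_sup_left, compl_inf_eq_bot, bot_sup_eq]
              exact sup_le (inf_le_of_right_le hqg) (inf_le_of_right_le h')
        rcases mem_principal_compl.1 (sup_gen_le_principal_compl h (h2.le hg)) with h'' | h''
        · exact Or.inr (Or.inr (Or.inl (le_antisymm h'' hpg)))
        · exact Or.inr (Or.inr (Or.inr (top_le_iff.1
            (sup_compl_eq_top (x := p) ▸ sup_le h'' hpg))))
    rcases mem_principal_compl.1 (hqc (h2.le hg)) with h' | h'
    · exact key gᶜ (compl_mem hg) (fun h => hgp (by simpa using compl_mem h))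
        (le_compl_comm.1 h')
    · exact key g hg hgp h'

end BooleanSubalgebra

/-! ### Directions as elements of the Boolean algebra of a chart -/

namespace Chart

variable {X : Type u} [PartialOrder X] [OrderBot X] {w : X} {B : Type*} [BooleanAlgebra B]
  (κ : Chart w B)

/-- The direction `d` is represented by the element `p` of the Boolean algebra of the chart. -/
def Rep (d : ODir X) (p : B) : Prop :=
  ∃ h : d.base ≤ w, d.val ⟨w, h⟩ = (κ.emb (principal p), κ.emb (principal pᶜ))

variable {κ} {d e f : ODir X} {p q r : B}

theorem Rep.base_eq (h : κ.Rep d p) : d.base = κ.emb (gen p) := by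
  obtain ⟨hd, h⟩ := h
  obtain ⟨q, hq⟩ := κ.exists_gen d.basic hd
  rw [← hq, κ.emb.injective.eq_iff, ← principal_inf_principal_compl,
    ← principal_inf_principal_compl]
  rcases κ.eq_or_eq_of_isPrincipalPairBelow hq (d.principal ⟨w, hd⟩) with h1 | h1 <;>
    rw [h, Prod.mk.injEq, κ.emb.injective.eq_iff, κ.emb.injective.eq_iff] at h1 <;>
    rw [h1.1, h1.2]
  exact inf_comm _ _

theorem Rep.base_le_iff (h : κ.Rep d p) {C : BooleanSubalgebra B} :
    d.base ≤ κ.emb C ↔ p ∈ C := by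
  rw [h.base_eq, κ.emb.le_iff_le, gen_le]

theorem Rep.compl (h : κ.Rep d p) : κ.Rep d.compl pᶜ := by
  obtain ⟨hd, h⟩ := h
  refine ⟨hd, (congrArg Prod.swap h).trans ?_⟩
  rw [_root_.compl_compl]
  rfl

variable (κ) in
theorem rep_zero : κ.Rep ODir.zero ⊥ := by
  refine ⟨bot_le, ?_⟩
  rw [principal_bot, compl_bot, principal_top, κ.emb_bot, κ.emb_top]
  rfl

variable (κ) in
theorem rep_one : κ.Rep ODir.one ⊤ := by
  rw [← compl_bot]
  exact κ.rep_zero.compl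

variable (κ) in
theorem exists_rep_of_le (hd : d.base ≤ w) : ∃ p, κ.Rep d p := by
  obtain ⟨q, hq⟩ := κ.exists_gen d.basic hd
  rcases κ.eq_or_eq_of_isPrincipalPairBelow hq (d.principal ⟨w, hd⟩) with h | h
  · exact ⟨q, hd, h⟩
  · exact ⟨qᶜ, hd, by rw [h, _root_.compl_compl]⟩

theorem Rep.eq (hw : ¬ IsBasic w) (h : κ.Rep d p) (h' : κ.Rep d q) : p = q := by
  have hp : gen p ≠ ⊤ := by
    intro ht
    apply hw
    rw [show w = d.base by rw [h.base_eq, ht, κ.emb_top]]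
    exact d.basic
  obtain ⟨hd, h⟩ := h
  obtain ⟨hd', h'⟩ := h'
  rw [h, Prod.mk.injEq, κ.emb.injective.eq_iff, κ.emb.injective.eq_iff] at h'
  exact principal_injective hp h'.1 h'.2

theorem Rep.dir_eq (hX : IsOrthodomain X) (hs : IsShort X) (hw : ¬ IsBasic w) (h : κ.Rep d p)
    (h' : κ.Rep e p) : d = e := by
  have hb : d.base = e.base := h.base_eq.trans h'.base_eq.symm
  obtain ⟨hd, h⟩ := h
  obtain ⟨he, h'⟩ := h'
  have hlt : d.base < w := lt_of_le_of_ne hd fun h => hw (h ▸ d.basic)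
  exact ODir.eq_of_val_eq hX hs hb hlt he (h.trans h'.symm)

variable (κ) in
theorem exists_rep (hX : HasEnoughDirections X) (p : B) : ∃ d, κ.Rep d p := by
  have hb : IsBasic (κ.emb (gen p)) := κ.isBasic_emb.2 (isBasic_iff.2 ⟨p, rfl⟩)
  obtain ⟨d, hd⟩ := hX.2 _ hb
  obtain ⟨q, hq⟩ := κ.exists_rep_of_le (hd.trans_le (κ.emb_le _))
  have := hd.symm.trans hq.base_eq
  rw [κ.emb.injective.eq_iff, gen_eq_gen] at this
  rcases this with rfl | rfl
  · exact ⟨d, hq⟩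
  · exact ⟨_, hq.compl⟩

theorem Rep.val_emb (h : κ.Rep d p) {C : BooleanSubalgebra B} (hC : d.base ≤ κ.emb C) :
    d.val ⟨κ.emb C, hC⟩ = (κ.emb (C ⊓ principal p), κ.emb (C ⊓ principal pᶜ)) := by
  obtain ⟨hd, h⟩ := h
  have := d.restrict ⟨_, hC⟩ ⟨w, hd⟩ (κ.emb_le C)
  rw [h] at this
  exact Prod.ext (this.1.unique (κ.isGLB _ _)) (this.2.unique (κ.isGLB _ _))

theorem Rep.val_emb_eq_left (h : κ.Rep d p) {C : BooleanSubalgebra B} (hC : d.base ≤ κ.emb C) :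
    d.val ⟨κ.emb C, hC⟩ = (d.base, κ.emb C) ↔ C ≤ principal pᶜ := by
  rw [h.val_emb, Prod.mk.injEq, h.base_eq, κ.emb.injective.eq_iff, κ.emb.injective.eq_iff,
    inf_eq_left]
  refine ⟨And.right, fun h' => ⟨le_antisymm ?_ (le_inf ?_ (gen_le.2 (Or.inl le_rfl))), h'⟩⟩
  · rw [← principal_inf_principal_compl]
    exact le_inf inf_le_right (inf_le_of_left_le h')
  · exact gen_le.2 (h.base_le_iff.1 hC)

theorem Rep.val_emb_eq_right (h : κ.Rep d p) {C : BooleanSubalgebra B} (hC : d.base ≤ κ.emb C) :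
    d.val ⟨κ.emb C, hC⟩ = (κ.emb C, d.base) ↔ C ≤ principal p := by
  have := h.compl.val_emb_eq_left hC
  rw [_root_.compl_compl] at this
  rw [← this]
  exact Prod.swap_injective.eq_iff.symm

theorem isAtom_base_iff (h : κ.Rep d p) : IsAtom d.base ↔ p ≠ ⊥ ∧ p ≠ ⊤ := by
  rw [h.base_eq, κ.isAtom_emb]
  refine ⟨fun h => ⟨?_, ?_⟩, fun h => isAtom_gen h.1 h.2⟩ <;> rintro rfl
  · exact h.1 (gen_eq_bot.2 (Or.inl rfl))
  · exact h.1 (gen_eq_bot.2 (Or.inr rfl))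

/-- The first three clauses of `⊕` are the cases where one of `p`, `q` is `⊥` or the two are
complementary. In the last clause the join of the bases is `gen p ⊔ gen q`, and the prescribed
values are the inclusions of `disjoint_and_sup_eq`. Conversely, `gen_covBy_sup` gives the covers
required of near atoms. -/
theorem sum_iff (hX : IsOrthodomain X) (hs : IsShort X) (hw : ¬ IsBasic w) (hd : κ.Rep d p)
    (he : κ.Rep e q) (hf : κ.Rep f r) : ODir.sum d e f ↔ Disjoint p q ∧ p ⊔ q = r := by
  constructor
  · rintro (⟨rfl, rfl⟩ | ⟨rfl, rfl⟩ | ⟨rfl, rfl⟩ |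
      ⟨v, hdv, hev, hfv, ⟨hda, hea, hne, hlub, hdc, hec⟩, hfa, hfd, hfe, vd, ve, vf⟩)
    · obtain rfl := he.eq hw κ.rep_zero
      obtain rfl := hd.eq hw hf
      simp
    · obtain rfl := hd.eq hw κ.rep_zero
      obtain rfl := he.eq hw hf
      simp
    · obtain rfl := he.eq hw hd.compl
      obtain rfl := hf.eq hw κ.rep_one
      exact ⟨disjoint_compl_right, sup_compl_eq_top⟩
    · have hvw : v ≤ w := hlub.2 (by
        rintro _ (rfl | rfl)
        · exact hd.1
        · exact he.1)
      obtain ⟨C, rfl⟩ := (κ.le_iff v).1 hvw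
      have hC : C = gen p ⊔ gen q := by
        apply le_antisymm
        · rw [← κ.emb.le_iff_le]
          refine hlub.2 ?_
          rintro _ (rfl | rfl)
          · exact hd.base_le_iff.2 ((le_sup_left : gen p ≤ _) (self_mem_gen p))
          · exact he.base_le_iff.2 ((le_sup_right : gen q ≤ _) (self_mem_gen q))
        · exact sup_le (gen_le.2 (hd.base_le_iff.1 hdv)) (gen_le.2 (he.base_le_iff.1 hev))
      rw [hd.val_emb_eq_left] at vd
      rw [he.val_emb_eq_left] at ve
      rw [hf.val_emb_eq_right] at vf
      rw [hf.base_le_iff] at hfv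
      rw [hd.base_eq, he.base_eq, ne_eq, κ.emb.injective.eq_iff] at hne
      rw [hf.base_eq, hd.base_eq, ne_eq, κ.emb.injective.eq_iff] at hfd
      rw [hf.base_eq, he.base_eq, ne_eq, κ.emb.injective.eq_iff] at hfe
      subst hC
      exact disjoint_and_sup_eq vd ve vf hfv ((isAtom_base_iff hf).1 hfa).2 hne hfd
        hfe
  · rintro ⟨hpq, rfl⟩
    by_cases hp : p = ⊥
    · subst hp
      rw [bot_sup_eq] at hf
      exact Or.inr (Or.inl ⟨hd.dir_eq hX hs hw κ.rep_zero, hf.dir_eq hX hs hw he⟩)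
    by_cases hq : q = ⊥
    · subst hq
      rw [sup_bot_eq] at hf
      exact Or.inl ⟨he.dir_eq hX hs hw κ.rep_zero, hf.dir_eq hX hs hw hd⟩
    by_cases hr : p ⊔ q = ⊤
    · have : q = pᶜ := (IsCompl.of_eq hpq.eq_bot hr).compl_eq.symm
      subst this
      rw [hr] at hf
      exact Or.inr (Or.inr (Or.inl ⟨he.dir_eq hX hs hw hd.compl, hf.dir_eq hX hs hw κ.rep_one⟩))
    have hpm : p ∈ gen p ⊔ gen q := (le_sup_left : gen p ≤ _) (self_mem_gen p)
    have hqm : q ∈ gen p ⊔ gen q := (le_sup_right : gen q ≤ _) (self_mem_gen q)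
    have hp1 : p ≠ ⊤ := by rintro rfl; simp at hr
    have hq1 : q ≠ ⊤ := by rintro rfl; simp at hr
    have hne : d.base ≠ e.base := by
      rw [hd.base_eq, he.base_eq, ne_eq, κ.emb.injective.eq_iff, gen_eq_gen]
      rintro (rfl | rfl)
      · exact hp (disjoint_self.1 hpq)
      · exact hr compl_sup_eq_top
    have hdc : d.base ⋖ κ.emb (gen p ⊔ gen q) := by
      rw [hd.base_eq, κ.emb_covBy]; exact gen_covBy_sup hpq hq hr
    have hec : e.base ⋖ κ.emb (gen p ⊔ gen q) := by
      rw [he.base_eq, κ.emb_covBy, sup_comm]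
      exact gen_covBy_sup hpq.symm hp (by rwa [sup_comm])
    have hda := (isAtom_base_iff hd).2 ⟨hp, hp1⟩
    have hea := (isAtom_base_iff he).2 ⟨hq, hq1⟩
    refine Or.inr (Or.inr (Or.inr ⟨κ.emb (gen p ⊔ gen q), hdc.le, hec.le,
      hf.base_le_iff.2 (sup_mem hpm hqm), ⟨hda, hea, hne,
        hX.isLUB_of_covBy _ _ _ hda hea hne hdc hec, hdc, hec⟩,
      (isAtom_base_iff hf).2 ⟨by simp [hp], hr⟩, ?_, ?_, ?_, ?_, ?_⟩))
    · rw [hf.base_eq, hd.base_eq, ne_eq, κ.emb.injective.eq_iff, gen_eq_gen]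
      rintro (h | h)
      · exact hq (disjoint_self.1 (hpq.mono_left (sup_eq_left.1 h)))
      · have : p ≤ pᶜ := le_sup_left.trans h.le
        exact hp (by simpa [le_compl_self] using this)
    · rw [hf.base_eq, he.base_eq, ne_eq, κ.emb.injective.eq_iff, gen_eq_gen]
      rintro (h | h)
      · exact hp (disjoint_self.1 (hpq.mono_right (sup_eq_right.1 h)))
      · have : q ≤ qᶜ := le_sup_right.trans h.le
        exact hq (by simpa [le_compl_self] using this)
    · rw [hd.val_emb_eq_left]; exact sup_gen_le_principal_compl hpq
    · rw [he.val_emb_eq_left, sup_comm]; exact sup_gen_le_principal_compl hpq.symm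
    · rw [hf.val_emb_eq_right]; exact sup_gen_le_principal_sup p q

end Chart

/-! ### Boolean embeddings into an orthoalgebra -/

/-- An embedding of a Boolean algebra whose image is closed under the existing sums. -/
structure IsBoolEmb {A : Type*} [OrthoData A] {B : Type*} [BooleanAlgebra B] (f : B → A) :
    Prop where
  injective : Function.Injective f
  map_bot : f ⊥ = ozero
  map_top : f ⊤ = oone
  map_compl : ∀ a, f aᶜ = ocompl (f a)
  osum_iff : ∀ a b c, osum (f a) (f b) c ↔ Disjoint a b ∧ f (a ⊔ b) = c

theorem BooleanSubalgebra.disjoint_coe {B : Type*} [BooleanAlgebra B] {D : BooleanSubalgebra B}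
    {a b : D} : Disjoint (a : B) b ↔ Disjoint a b := by
  rw [disjoint_iff, disjoint_iff, ← val_inf, ← val_bot, Subtype.coe_inj]

theorem IsBoolEmb.restrict {A : Type*} [OrthoData A] {B : Type*} [BooleanAlgebra B] {f : B → A}
    (hf : IsBoolEmb f) (D : BooleanSubalgebra B) : IsBoolEmb (fun b : D => f b) where
  injective := hf.injective.comp Subtype.val_injective
  map_bot := hf.map_bot
  map_top := hf.map_top
  map_compl a := hf.map_compl a
  osum_iff a b c := by rw [hf.osum_iff, disjoint_coe]; rfl

namespace BSub

variable {A : Type u} [OrthoData A]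

theorem le_iff {S T : BSub A} : S ≤ T ↔ S.carrier ⊆ T.carrier := Iff.rfl

theorem isBoolEmb (S : BSub A) :
    ∃ _ : BooleanAlgebra S.carrier, IsBoolEmb (Subtype.val : S.carrier → A) := by
  obtain ⟨h, h0, h1, hc, hs⟩ := S.2
  let inst : BooleanAlgebra S.carrier := h
  refine ⟨inst, Subtype.val_injective, ?_, ?_, ?_, ?_⟩
  · exact congrArg Subtype.val h0.symm
  · exact congrArg Subtype.val h1.symm
  · exact fun a => congrArg Subtype.val (hc a).symm
  · intro a b c
    constructor
    · intro habc
      have hcS : c ∈ S.carrier := S.1.sum_mem _ a.2 _ b.2 _ habc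
      have := (hs a b ⟨c, hcS⟩).1 habc
      exact ⟨this.1, congrArg Subtype.val this.2⟩
    · rintro ⟨hd, rfl⟩
      exact (hs a b (a ⊔ b)).2 ⟨hd, rfl⟩

section OfEmb

variable {B : Type*} [BooleanAlgebra B] {f : B → A} (hf : IsBoolEmb f)

/-- The range of a Boolean embedding. -/
def ofEmb : BSub A :=
  ⟨{ carrier := Set.range f
     zero_mem := ⟨⊥, hf.map_bot⟩
     one_mem := ⟨⊤, hf.map_top⟩
     compl_mem := by
      rintro _ ⟨a, rfl⟩
      exact ⟨aᶜ, hf.map_compl a⟩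
     sum_mem := by
      rintro _ ⟨a, rfl⟩ _ ⟨b, rfl⟩ c h
      exact ⟨a ⊔ b, ((hf.osum_iff a b c).1 h).2⟩ }, by
    let e : Set.range f ≃ B := (Equiv.ofInjective f hf.injective).symm
    have he : ∀ b, e.symm b = ⟨f b, b, rfl⟩ := fun b => rfl
    refine ⟨e.booleanAlgebra, ?_, ?_, ?_, ?_⟩
    · exact Subtype.ext hf.map_bot.symm
    · exact Subtype.ext hf.map_top.symm
    · intro a
      obtain ⟨b, rfl⟩ := e.symm.surjective a
      change _ = e.symm (e (e.symm b))ᶜ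
      rw [e.apply_symm_apply]
      exact Subtype.ext (hf.map_compl b).symm
    · intro a b c
      obtain ⟨a, rfl⟩ := e.symm.surjective a
      obtain ⟨b, rfl⟩ := e.symm.surjective b
      let _ := e.booleanAlgebra
      have h1 : e.symm a ⊔ e.symm b = e.symm (a ⊔ b) := by
        change e.symm (e (e.symm a) ⊔ e (e.symm b)) = _
        rw [e.apply_symm_apply, e.apply_symm_apply]
      have h2 : Disjoint (e.symm a) (e.symm b) ↔ Disjoint a b := by
        rw [disjoint_iff, disjoint_iff]
        change e.symm (e (e.symm a) ⊓ e (e.symm b)) = e.symm ⊥ ↔ _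
        rw [e.apply_symm_apply, e.apply_symm_apply, e.symm.injective.eq_iff]
      rw [h1, h2, Subtype.ext_iff]
      exact hf.osum_iff a b c⟩

theorem carrier_ofEmb : (ofEmb hf).carrier = Set.range f := rfl

theorem carrier_ofEmb_restrict (D : BooleanSubalgebra B) :
    (ofEmb (hf.restrict D)).carrier = f '' D := by
  rw [carrier_ofEmb]
  ext a
  simp

/-- The Boolean subalgebras below the range of a Boolean embedding. -/
def chart : Chart (ofEmb hf) B where
  emb := OrderEmbedding.ofMapLEIff (fun D => ofEmb (hf.restrict D)) fun D E => by
    rw [le_iff, carrier_ofEmb_restrict hf, carrier_ofEmb_restrict hf,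
      Set.image_subset_image_iff hf.injective]
    rfl
  le_iff T := by
    constructor
    · intro hT
      obtain ⟨_, hg⟩ := T.isBoolEmb
      choose h hh using fun t : T.carrier => (hT t.2 : t.1 ∈ Set.range f)
      have hdisj : ∀ s t : T.carrier, Disjoint s t → h (s ⊔ t) = h s ⊔ h t := by
        intro s t hst
        have := (hg.osum_iff s t _).2 ⟨hst, rfl⟩
        rw [← hh, ← hh, ← hh, hf.osum_iff, hf.injective.eq_iff] at this
        exact this.2.symm
      -- `T` carries its own Boolean structure. Its joins agree with those of `B` on disjoint pairs,
      -- both being `⊕`; the general case follows by splitting `t` into `t ⊓ s` and `t \ s`.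
      have hsup : ∀ s t : T.carrier, h (s ⊔ t) = h s ⊔ h t := by
        intro s t
        have h1 : h (s ⊔ t) = h s ⊔ h (t \ s) := by
          rw [← hdisj _ _ disjoint_sdiff_self_right, sup_sdiff_self_right]
        have h2 : h t = h (t ⊓ s) ⊔ h (t \ s) := by
          rw [← hdisj _ _ disjoint_inf_sdiff, sup_inf_sdiff]
        have h3 : h s = h (s ⊓ t) ⊔ h (s \ t) := by
          rw [← hdisj _ _ disjoint_inf_sdiff, sup_inf_sdiff]
        rw [h1]
        apply le_antisymm
        · exact sup_le_sup_left (h2 ▸ le_sup_right) _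
        · refine sup_le le_sup_left ?_
          rw [h2]
          refine sup_le_sup_right ?_ _
          rw [h3, inf_comm]
          exact le_sup_left
      have hmem : ∀ b, f b ∈ T.carrier → ∃ t, h t = b :=
        fun b hb => ⟨⟨f b, hb⟩, hf.injective (hh _)⟩
      have hsupm : ∀ a b, f a ∈ T.carrier → f b ∈ T.carrier → f (a ⊔ b) ∈ T.carrier := by
        intro a b ha hb
        obtain ⟨s, rfl⟩ := hmem a ha
        obtain ⟨t, rfl⟩ := hmem b hb
        rw [← hsup, hh]
        exact (s ⊔ t).2
      have hcm : ∀ a, f a ∈ T.carrier → f aᶜ ∈ T.carrier := by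
        intro a ha
        rw [hf.map_compl]
        exact T.1.compl_mem _ ha
      let D : BooleanSubalgebra B :=
        { carrier := {b | f b ∈ T.carrier}
          supClosed' := fun a ha b hb => hsupm a b ha hb
          infClosed' := fun a ha b hb => by
            have := hcm _ (hsupm _ _ (hcm a ha) (hcm b hb))
            rwa [compl_sup, _root_.compl_compl, _root_.compl_compl] at this
          compl_mem' := fun {a} ha => hcm a ha
          bot_mem' := by
            change f ⊥ ∈ T.carrier
            rw [hf.map_bot]
            exact T.1.zero_mem }
      refine ⟨D, carrier_injective ?_⟩
      refine (carrier_ofEmb_restrict hf D).trans (Set.ext fun a => ⟨?_, fun ha => ?_⟩)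
      · rintro ⟨b, hb, rfl⟩
        exact hb
      · obtain ⟨b, rfl⟩ := hT ha
        exact ⟨b, ha, rfl⟩
    · rintro ⟨D, rfl⟩
      rw [le_iff]
      refine (carrier_ofEmb_restrict hf D).subset.trans ?_
      exact Set.image_subset_range _ _

theorem carrier_chart (D : BooleanSubalgebra B) : ((chart hf).emb D).carrier = f '' D :=
  carrier_ofEmb_restrict hf D

end OfEmb

theorem ofEmb_val (S : BSub A) [BooleanAlgebra S.carrier]
    (h : IsBoolEmb (Subtype.val : S.carrier → A)) : ofEmb h = S :=
  carrier_injective Subtype.range_val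

end BSub

/-! ### Heights -/

theorem Order.height_orderEmbedding {α β : Type*} [PartialOrder α] [PartialOrder β] (f : α ↪o β)
    (h : ∀ a b, b ≤ f a → ∃ a', f a' = b) (a : α) : Order.height (f a) = Order.height a := by
  refine (Order.height_eq_of_strictMono f f.strictMono (fun a b hb => ?_) a).symm
  obtain ⟨a', rfl⟩ := h a b hb.le
  exact ⟨a', f.lt_iff_lt.1 hb, rfl⟩

theorem Chart.height_emb {X : Type*} [PartialOrder X] {w : X} {B : Type*} [BooleanAlgebra B]
    (κ : Chart w B) (C : BooleanSubalgebra B) : Order.height (κ.emb C) = Order.height C :=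
  Order.height_orderEmbedding κ.emb (fun _ _ h => (κ.exists_of_le h).imp fun _ h => h.2) C

/-! ### Cardinality and height of subalgebras, and partitions of the unit -/

namespace BooleanSubalgebra

variable {B : Type*} [BooleanAlgebra B]

/-- Translating `C` by symmetric difference with an element of `D` outside `C` gives a disjoint copy
of `C` inside `D`. -/
theorem two_mul_encard_le {C D : BooleanSubalgebra B} (h : C < D) :
    2 * (C : Set B).encard ≤ (D : Set B).encard := by
  obtain ⟨d, hd, hdC⟩ := SetLike.exists_of_lt h
  have hinj : Function.Injective (fun c => symmDiff d c) := symmDiff_right_injective d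
  have hdisj : Disjoint (C : Set B) ((fun c => symmDiff d c) '' C) := by
    rw [Set.disjoint_left]
    rintro _ hc ⟨c, hc', rfl⟩
    apply hdC
    have : symmDiff (symmDiff d c) c ∈ C := sup_mem (sdiff_mem hc hc') (sdiff_mem hc' hc)
    rwa [symmDiff_symmDiff_cancel_right] at this
  calc 2 * (C : Set B).encard = (C ∪ (fun c => symmDiff d c) '' C : Set B).encard := by
        rw [Set.encard_union_eq hdisj, hinj.encard_image, two_mul]
    _ ≤ (D : Set B).encard := by
        refine Set.encard_le_encard (Set.union_subset h.le ?_)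
        rintro _ ⟨c, hc, rfl⟩
        exact sup_mem (sdiff_mem hd (h.le hc)) (sdiff_mem (h.le hc) hd)

/-- Each step of a chain at least doubles the cardinality. The exponent is `n + 1` because a
subalgebra of height 0 may already have two elements. -/
theorem height_le_of_encard_le (n : ℕ) (C : BooleanSubalgebra B)
    (h : (C : Set B).encard ≤ 2 ^ (n + 1)) : Order.height C ≤ n := by
  induction n generalizing C with
  | zero =>
    rw [Nat.cast_zero, nonpos_iff_eq_zero, Order.height_eq_zero]
    intro D hD
    by_contra hlt
    have h1 := two_mul_encard_le (lt_of_le_not_ge hD hlt)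
    have h2 : (D : Set B).encard ≤ 1 := by
      have h3 := h1.trans h
      rw [zero_add, pow_one] at h3
      by_contra! h4
      have h5 : (2 : ℕ∞) ≤ (D : Set B).encard := by
        simpa [one_add_one_eq_two] using Order.add_one_le_of_lt h4
      have : (2 : ℕ∞) * 2 ≤ 2 := (mul_le_mul_right h5 2).trans h3
      exact absurd this (by decide)
    have h3 := Set.encard_le_one_iff.1 h2 ⊥ ⊤ bot_mem top_mem
    refine hlt fun c _ => ?_
    have : c = ⊥ := le_bot_iff.1 (h3 ▸ le_top)
    rw [this]
    exact bot_mem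
  | succ n ih =>
    rw [Order.height_le_coe_iff]
    intro D hD
    have h1 := (two_mul_encard_le hD).trans h
    rw [pow_succ' 2 (n + 1)] at h1
    have h2 : (D : Set B).encard ≤ 2 ^ (n + 1) :=
      (ENat.mul_le_mul_left_iff (by decide) (by decide)).1 h1
    refine (ih D h2).trans_lt ?_
    exact_mod_cast Nat.lt_succ_self n

/-- No member of `S` separates `b` from `c`, whereas `b` does. -/
theorem lt_sup_gen {S : BooleanSubalgebra B} {b c : B} (hbc : Disjoint b c) (hb : b ≠ ⊥)
    (hc : c ≠ ⊥) (hS : S ≤ principal (b ⊔ c)ᶜ) : S < S ⊔ gen b := by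
  refine lt_of_le_of_ne le_sup_left fun h => ?_
  have hbS : b ∈ S := by rw [h]; exact (le_sup_right : gen b ≤ _) (self_mem_gen b)
  rcases mem_principal_compl.1 (hS hbS) with h | h
  · exact hb (disjoint_self.1 ((le_compl_iff_disjoint_right.1 h).mono_right le_sup_left))
  · exact hc (disjoint_self.1 (hbc.mono_left (le_sup_right.trans h)))

/-- Adjoining `a`, `b`, `c`, `d` in turn to `⊥` gives a strict chain: nothing generated so far
separates the new element from the next in the list. The fifth element is what `d` has to be
separated from. -/
theorem four_le_height {a b c d e : B} (h : [a, b, c, d, e].Pairwise Disjoint)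
    (h0 : ∀ x ∈ [a, b, c, d, e], x ≠ ⊥) :
    4 ≤ Order.height (⊤ : BooleanSubalgebra B) := by
  simp only [List.pairwise_cons, List.mem_cons, List.not_mem_nil, or_false, forall_eq_or_imp,
    forall_eq] at h h0
  obtain ⟨⟨ab, ac, ad, ae⟩, ⟨bc, bd, be⟩, ⟨cd, ce⟩, de, _⟩ := h
  obtain ⟨ha, hb, hc, hd, he⟩ := h0
  have key : ∀ {x y z : B}, Disjoint x y → Disjoint x z → gen x ≤ principal (y ⊔ z)ᶜ :=
    fun h1 h2 => gen_le.2 (Or.inl (le_compl_iff_disjoint_right.2 (h1.sup_right h2)))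
  have h1 := Order.height_add_one_le
    (lt_sup_gen ab ha hb (bot_le : (⊥ : BooleanSubalgebra B) ≤ _))
  have h2 := Order.height_add_one_le
    (lt_sup_gen bc hb hc (sup_le (bot_le : (⊥ : BooleanSubalgebra B) ≤ _) (key ab ac)))
  have h3 := Order.height_add_one_le (lt_sup_gen cd hc hd
    (sup_le (sup_le (bot_le : (⊥ : BooleanSubalgebra B) ≤ _) (key ac ad)) (key bc bd)))
  have h4 := Order.height_add_one_le (lt_sup_gen de hd he
    (sup_le (sup_le (sup_le (bot_le : (⊥ : BooleanSubalgebra B) ≤ _) (key ad ae)) (key bd be))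
      (key cd ce)))
  calc (4 : ℕ∞) = 0 + 1 + 1 + 1 + 1 := rfl
    _ ≤ Order.height (⊥ : BooleanSubalgebra B) + 1 + 1 + 1 + 1 := by gcongr; exact zero_le
    _ ≤ _ := by grw [h1, h2, h3, h4]; exact Order.height_mono le_top

/-- Every element of `B` contains `p` or is disjoint from it. -/
def IsSmall (p : B) : Prop := ∀ b : B, b ⊓ p = ⊥ ∨ b ⊓ p = p

/-- A finite partition of the unit. -/
def IsPartition (l : List B) : Prop :=
  l.Pairwise Disjoint ∧ (∀ x ∈ l, x ≠ ⊥) ∧ l.foldr (· ⊔ ·) ⊥ = ⊤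

theorem IsPartition.perm {l l' : List B} (h : IsPartition l) (hl : l.Perm l') :
    IsPartition l' :=
  ⟨(hl.pairwise_iff fun h => h.symm).1 h.1, fun x hx => h.2.1 x (hl.mem_iff.2 hx),
    by rw [← h.2.2]; exact (hl.foldr_eq ⊥).symm⟩

theorem IsPartition.split {l : List B} {p b : B} (h : IsPartition (p :: l)) (h0 : b ⊓ p ≠ ⊥)
    (h1 : b ⊓ p ≠ p) : IsPartition ((b ⊓ p) :: (p \ b) :: l) := by
  obtain ⟨hp, hn, hs⟩ := h
  rw [List.pairwise_cons] at hp
  refine ⟨?_, ?_, ?_⟩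
  · rw [List.pairwise_cons, List.pairwise_cons]
    refine ⟨?_, fun x hx => (hp.1 x hx).mono_left sdiff_le, hp.2⟩
    intro x hx
    rcases List.mem_cons.1 hx with rfl | hx
    · exact disjoint_sdiff_self_right.mono_left inf_le_left
    · exact (hp.1 x hx).mono_left inf_le_right
  · intro x hx
    rcases List.mem_cons.1 hx with rfl | hx
    · exact h0
    rcases List.mem_cons.1 hx with rfl | hx
    · exact fun h => h1 (inf_eq_right.2 (sdiff_eq_bot_iff.1 h))
    · exact hn x (List.mem_cons_of_mem _ hx)
  · rw [← hs, List.foldr_cons, List.foldr_cons, List.foldr_cons, ← sup_assoc, inf_comm,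
      sup_inf_sdiff]

theorem IsPartition.length_le {l : List B} (h : IsPartition l)
    (hB : Order.height (⊤ : BooleanSubalgebra B) ≤ 3) : l.length ≤ 4 := by
  by_contra! hl
  match l, hl with
  | a :: b :: c :: d :: e :: l, _ =>
    have h1 : [a, b, c, d, e].Sublist (a :: b :: c :: d :: e :: l) := by simp
    have := four_le_height (h.1.sublist h1) fun x hx => h.2.1 x (h1.subset hx)
    exact absurd (this.trans hB) (by decide)

theorem exists_isPartition_isSmall (hB : Order.height (⊤ : BooleanSubalgebra B) ≤ 3) :
    ∃ l : List B, IsPartition l ∧ ∀ p ∈ l, IsSmall p := by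
  -- `n` bounds the remaining splits. Each split lengthens the partition by one, and length five is
  -- impossible, so the process stops at unsplittable pieces.
  have main : ∀ n : ℕ, ∀ l : List B, IsPartition l → l.length + n = 5 →
      ∃ l : List B, IsPartition l ∧ ∀ p ∈ l, IsSmall p := by
    intro n
    induction n with
    | zero =>
      intro l hl h
      have := hl.length_le hB
      omega
    | succ n ih =>
      intro l hl h
      by_cases hs : ∀ p ∈ l, IsSmall p
      · exact ⟨l, hl, hs⟩
      · unfold IsSmall at hs
        push Not at hs
        obtain ⟨p, hp, b, h0, h1⟩ := hs
        obtain ⟨s, t, rfl⟩ := List.append_of_mem hp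
        have hl' := List.perm_middle (a := p) (l₁ := s) (l₂ := t)
        refine ih _ ((hl.perm hl').split h0 h1) ?_
        have := hl'.length_eq
        simp only [List.length_cons] at this ⊢
        omega
  by_cases h : (⊤ : B) = ⊥
  · exact ⟨[], ⟨List.Pairwise.nil, by simp, by simp [h]⟩, by simp⟩
  · exact main 4 [⊤] ⟨List.pairwise_singleton _ _, by simpa using h, by simp⟩ (by simp)

/-- A Boolean algebra whose lattice of subalgebras has height at most `3` has at most four
atoms. -/
theorem exists_four_isSmall (hB : Order.height (⊤ : BooleanSubalgebra B) ≤ 3) :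
    ∃ p q r s : B, Disjoint p q ∧ Disjoint (p ⊔ q) r ∧ s = (p ⊔ q ⊔ r)ᶜ ∧
      IsSmall p ∧ IsSmall q ∧ IsSmall r ∧ IsSmall s := by
  have hbot : IsSmall (⊥ : B) := fun b => Or.inl (inf_bot_eq b)
  obtain ⟨l, hl, hs⟩ := exists_isPartition_isSmall hB
  have hlen := hl.length_le hB
  obtain ⟨hp, -, hsup⟩ := hl
  match l, hlen with
  | [], _ =>
    have : (⊥ : B) = ⊤ := by simpa using hsup
    exact ⟨⊥, ⊥, ⊥, ⊥, by simp, by simp, by simp [this], hbot, hbot, hbot, hbot⟩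
  | [a], _ =>
    obtain rfl : a = ⊤ := by simpa using hsup
    exact ⟨⊤, ⊥, ⊥, ⊥, by simp, by simp, by simp, hs _ (by simp), hbot, hbot, hbot⟩
  | [a, b], _ =>
    have h : a ⊔ b = ⊤ := by simpa using hsup
    exact ⟨a, b, ⊥, ⊥, by simpa using hp, by simp, by simp [h], hs _ (by simp), hs _ (by simp),
      hbot, hbot⟩
  | [a, b, c], _ =>
    have h : a ⊔ b ⊔ c = ⊤ := by simpa [sup_assoc] using hsup
    simp only [List.pairwise_cons, List.mem_cons, List.not_mem_nil, or_false, forall_eq_or_imp,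
      forall_eq] at hp
    exact ⟨a, b, c, ⊥, hp.1.1, hp.1.2.sup_left hp.2.1, by rw [h, compl_top], hs _ (by simp),
      hs _ (by simp), hs _ (by simp), hbot⟩
  | [a, b, c, d], _ =>
    have h : a ⊔ b ⊔ c ⊔ d = ⊤ := by simpa [sup_assoc] using hsup
    simp only [List.pairwise_cons, List.mem_cons, List.not_mem_nil, or_false, forall_eq_or_imp,
      forall_eq] at hp
    obtain ⟨⟨ab, ac, ad⟩, ⟨bc, bd⟩, cd, _⟩ := hp
    refine ⟨a, b, c, d, ab, ac.sup_left bc, ?_, hs _ (by simp), hs _ (by simp),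
      hs _ (by simp), hs _ (by simp)⟩
    exact (IsCompl.of_eq ((ad.sup_left bd).sup_left cd).eq_bot h).compl_eq.symm

end BooleanSubalgebra

/-! ### The orthoalgebra of directions -/

section Directions

variable {X : Type u} [PartialOrder X] [OrderBot X]

theorem not_isBasic_of_isAtom_lt {x v : X} (hx : IsAtom x) (h : x < v) : ¬ IsBasic v := by
  rintro (rfl | hv)
  · exact not_lt_bot h
  · exact hx.1 (hv.2 x h)

theorem not_isBasic_mono {v w : X} (hv : ¬ IsBasic v) (h : v ≤ w) : ¬ IsBasic w := by
  rintro (rfl | hw)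
  · exact hv (Or.inl (le_bot_iff.1 h))
  · rcases hw.le_iff.1 h with rfl | rfl
    · exact hv (Or.inl rfl)
    · exact hv (Or.inr hw)

namespace ODir

variable {a b c s t d e f : ODir X}

theorem exists_of_sum (hE : HasEnoughDirections X) (h : sum d e f) :
    ∃ w, ¬ IsBasic w ∧ d.base ≤ w ∧ e.base ≤ w ∧ f.base ≤ w := by
  rcases h with ⟨rfl, rfl⟩ | ⟨rfl, rfl⟩ | ⟨rfl, rfl⟩ |
    ⟨v, hdv, hev, hfv, ⟨hda, hea, hne, hlub, hdc, hec⟩, _⟩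
  · obtain ⟨w, hw, hb⟩ := hE.exists_not_isBasic f.base
    exact ⟨w, hb, hw, bot_le, hw⟩
  · obtain ⟨w, hw, hb⟩ := hE.exists_not_isBasic f.base
    exact ⟨w, hb, bot_le, hw, hw⟩
  · obtain ⟨w, hw, hb⟩ := hE.exists_not_isBasic d.base
    exact ⟨w, hb, hw, hw, bot_le⟩
  · exact ⟨v, not_isBasic_of_isAtom_lt hda hdc.lt, hdv, hev, hfv⟩

theorem sum_base_le (h : sum d e f) {w : X} (hd : d.base ≤ w) (he : e.base ≤ w) : f.base ≤ w := by
  rcases h with ⟨rfl, rfl⟩ | ⟨rfl, rfl⟩ | ⟨rfl, rfl⟩ | ⟨v, _, _, hfv, ⟨_, _, _, hlub, _⟩, _⟩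
  · exact hd
  · exact he
  · exact bot_le
  · refine hfv.trans (hlub.2 ?_)
    rintro _ (rfl | rfl)
    · exact hd
    · exact he

theorem zero_ne_one (hX : IsOrthodomain X) (hE : HasEnoughDirections X) :
    (zero : ODir X) ≠ one := by
  intro h
  obtain ⟨w, -, hw⟩ := hE.exists_not_isBasic ⊥
  obtain ⟨B, _, ⟨κ⟩⟩ := hX.exists_chart w
  have h1 : (⊥ : B) = ⊤ := κ.rep_zero.eq hw (h ▸ κ.rep_one)
  apply hw
  rw [← κ.emb_top, κ.isBasic_emb]
  refine isBasic_iff.2 ⟨⊥, (top_le_iff.1 fun c _ => ?_).symm⟩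
  exact Or.inl (le_bot_iff.1 (h1 ▸ le_top))

theorem sum_rotate (hX : IsOrthodomain X) (hs : IsShort X) (hE : HasEnoughDirections X)
    (h : sum d e f) : sum d f.compl e.compl := by
  obtain ⟨w, hw, hd, he, hf⟩ := exists_of_sum hE h
  obtain ⟨B, _, ⟨κ⟩⟩ := hX.exists_chart w
  obtain ⟨p, hp⟩ := κ.exists_rep_of_le hd
  obtain ⟨q, hq⟩ := κ.exists_rep_of_le he
  obtain ⟨r, hr⟩ := κ.exists_rep_of_le hf
  rw [κ.sum_iff hX hs hw hp hr.compl hq.compl]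
  obtain ⟨h1, rfl⟩ := (κ.sum_iff hX hs hw hp hq hr).1 h
  refine ⟨disjoint_compl_right.mono_left le_sup_left, ?_⟩
  rw [compl_sup, sup_inf_left, sup_compl_eq_top, top_inf_eq]
  exact sup_eq_right.2 (le_compl_iff_disjoint_right.2 h1)

/-- The definition of `⊕` says that the join covers the bases of the two summands but not that it
covers the third atom. Rotating the sum makes the third atom the base of a summand, which supplies
the cover needed to apply condition (iii). -/
theorem base_covBy_of_sum (hX : IsOrthodomain X) (hs : IsShort X) (hE : HasEnoughDirections X)
    (h : sum d e f) {v : X} (hd : d.base ⋖ v) (he : e.base ≤ v) (hda : IsAtom d.base)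
    (hfa : IsAtom f.base) (hfd : f.base ≠ d.base) : f.base ⋖ v := by
  have hfv := sum_base_le h hd.le he
  rcases sum_rotate hX hs hE h with ⟨h1, _⟩ | ⟨h1, _⟩ | ⟨h1, _⟩ |
    ⟨u, _, _, _, ⟨_, _, _, hlub, hdc, hfc⟩, _⟩
  · exact absurd (congrArg ODir.base h1) hfa.1
  · exact absurd (congrArg ODir.base h1) hda.1
  · exact absurd (congrArg ODir.base h1) hfd
  · have huv : u ≤ v := hlub.2 (by
      rintro _ (rfl | rfl)
      · exact hd.le
      · exact hfv)
    rcases hd.eq_or_eq hdc.le huv with rfl | rfl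
    · exact absurd rfl hdc.ne
    · exact hfc

/-- The members of an iterated sum lie below a common element. -/
theorem exists_of_sum_sum (hX : IsOrthodomain X) (hs : IsShort X) (hE : HasEnoughDirections X)
    (h₁ : sum a b s) (h₂ : sum s c t) :
    ∃ w, ¬ IsBasic w ∧ a.base ≤ w ∧ b.base ≤ w ∧ c.base ≤ w := by
  have h₁' := h₁
  have h₂' := h₂
  rcases h₁' with ⟨rfl, rfl⟩ | ⟨rfl, rfl⟩ | ⟨rfl, rfl⟩ |
    ⟨v, hav, hbv, hsv, ⟨haa, hba, hne, hlub, hac, hbc⟩, hsa, hsna, hsnb, va, vb, vs⟩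
  · obtain ⟨w, hw, h1, h2, h3⟩ := exists_of_sum hE h₂
    exact ⟨w, hw, h1, bot_le, h2⟩
  · obtain ⟨w, hw, h1, h2, h3⟩ := exists_of_sum hE h₂
    exact ⟨w, hw, bot_le, h1, h2⟩
  · obtain ⟨w, hw, hb⟩ := hE.exists_not_isBasic a.base
    refine ⟨w, hb, hw, hw, ?_⟩
    rcases h₂' with ⟨rfl, _⟩ | ⟨h, _⟩ | ⟨rfl, _⟩ | ⟨_, _, _, _, ⟨h, _⟩, _⟩
    · exact bot_le
    · exact absurd h.symm (zero_ne_one hX hE)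
    · exact bot_le
    · exact absurd rfl h.1
  · have hv := not_isBasic_of_isAtom_lt haa hac.lt
    rcases h₂' with ⟨rfl, _⟩ | ⟨h, _⟩ | ⟨rfl, _⟩ |
      ⟨v', hsv', hcv', htv', ⟨_, _, _, _, hsc, _⟩, _, _, _, vs', _⟩
    · exact ⟨v, hv, hav, hbv, bot_le⟩
    · exact absurd (congrArg ODir.base h) hsa.1
    · exact ⟨v, hv, hav, hbv, hsv⟩
    -- As a summand `s` has value (base, `v'`) at `v'`; as a sum it has value (`v`, base) at `v`.
    -- These are the opposite orientations in condition (iii), so some `u` lies above both covers.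
    · obtain ⟨u, _, h1, h2⟩ := s.join ⟨v', hsv'⟩ ⟨v, hsv⟩ hsc
        (base_covBy_of_sum hX hs hE h₁ hac hbv haa hsa hsna) vs' vs
      exact ⟨u, not_isBasic_mono hv h2.le, hav.trans h2.le, hbv.trans h2.le, hcv'.trans h1.le⟩

/-- All directions in a law lie below one element that is not basic, and the law is then the
corresponding fact about disjoint joins in the Boolean algebra of its chart. -/
theorem isOrthoalgebra (hX : IsOrthodomain X) (hs : IsShort X) (hE : HasEnoughDirections X) :
    IsOrthoalgebra (ODir X) where
  sum_unique a b c c' h h' := by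
    obtain ⟨w, hw, ha, hb, hc⟩ := exists_of_sum hE h
    obtain ⟨B, _, ⟨κ⟩⟩ := hX.exists_chart w
    obtain ⟨p, hp⟩ := κ.exists_rep_of_le ha
    obtain ⟨q, hq⟩ := κ.exists_rep_of_le hb
    obtain ⟨r, hr⟩ := κ.exists_rep_of_le hc
    obtain ⟨r', hr'⟩ := κ.exists_rep_of_le (sum_base_le h' ha hb)
    obtain rfl := ((κ.sum_iff hX hs hw hp hq hr).1 h).2
    obtain rfl := ((κ.sum_iff hX hs hw hp hq hr').1 h').2
    exact hr.dir_eq hX hs hw hr'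
  sum_comm a b c h := by
    obtain ⟨w, hw, ha, hb, hc⟩ := exists_of_sum hE h
    obtain ⟨B, _, ⟨κ⟩⟩ := hX.exists_chart w
    obtain ⟨p, hp⟩ := κ.exists_rep_of_le ha
    obtain ⟨q, hq⟩ := κ.exists_rep_of_le hb
    obtain ⟨r, hr⟩ := κ.exists_rep_of_le hc
    obtain ⟨h1, rfl⟩ := (κ.sum_iff hX hs hw hp hq hr).1 h
    exact (κ.sum_iff hX hs hw hq hp hr).2 ⟨h1.symm, sup_comm _ _⟩
  sum_assoc a b c s t h₁ h₂ := by
    obtain ⟨w, hw, ha, hb, hc⟩ := exists_of_sum_sum hX hs hE h₁ h₂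
    have hs' := sum_base_le h₁ ha hb
    obtain ⟨B, _, ⟨κ⟩⟩ := hX.exists_chart w
    obtain ⟨p, hp⟩ := κ.exists_rep_of_le ha
    obtain ⟨q, hq⟩ := κ.exists_rep_of_le hb
    obtain ⟨r, hr⟩ := κ.exists_rep_of_le hc
    obtain ⟨y, hy⟩ := κ.exists_rep_of_le hs'
    obtain ⟨z, hz⟩ := κ.exists_rep_of_le (sum_base_le h₂ hs' hc)
    obtain ⟨h1, rfl⟩ := (κ.sum_iff hX hs hw hp hq hy).1 h₁
    obtain ⟨h2, rfl⟩ := (κ.sum_iff hX hs hw hy hr hz).1 h₂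
    obtain ⟨x, hx⟩ := κ.exists_rep hE (q ⊔ r)
    refine ⟨x, (κ.sum_iff hX hs hw hq hr hx).2 ⟨h2.mono_left le_sup_right, rfl⟩,
      (κ.sum_iff hX hs hw hp hx hz).2 ⟨h1.sup_right (h2.mono_left le_sup_left),
        (sup_assoc _ _ _).symm⟩⟩
  sum_eq_one_iff a b := by
    constructor
    · intro h
      obtain ⟨w, hw, ha, hb, hc⟩ := exists_of_sum hE h
      obtain ⟨B, _, ⟨κ⟩⟩ := hX.exists_chart w
      obtain ⟨p, hp⟩ := κ.exists_rep_of_le ha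
      obtain ⟨q, hq⟩ := κ.exists_rep_of_le hb
      obtain ⟨h1, h2⟩ := (κ.sum_iff hX hs hw hp hq κ.rep_one).1 h
      obtain rfl : pᶜ = q := (IsCompl.of_eq h1.eq_bot h2).compl_eq
      exact hq.dir_eq hX hs hw hp.compl
    · rintro rfl
      exact Or.inr (Or.inr (Or.inl ⟨rfl, rfl⟩))
  sum_self_iff a := by
    constructor
    · rintro ⟨c, h⟩
      obtain ⟨w, hw, ha, -, hc⟩ := exists_of_sum hE h
      obtain ⟨B, _, ⟨κ⟩⟩ := hX.exists_chart w
      obtain ⟨p, hp⟩ := κ.exists_rep_of_le ha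
      obtain ⟨r, hr⟩ := κ.exists_rep_of_le hc
      have h1 := ((κ.sum_iff hX hs hw hp hp hr).1 h).1
      rw [disjoint_self] at h1
      subst h1
      exact hp.dir_eq hX hs hw κ.rep_zero
    · rintro rfl
      exact ⟨zero, Or.inl ⟨rfl, rfl⟩⟩

theorem exists_isBoolEmb (hX : IsOrthodomain X) (hs : IsShort X) (hE : HasEnoughDirections X)
    {w : X} (hw : ¬ IsBasic w) {B : Type u} [BooleanAlgebra B] (κ : Chart w B) :
    ∃ f : B → ODir X, IsBoolEmb f ∧ ∀ C : BooleanSubalgebra B,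
      f '' C = {d | d.base ≤ κ.emb C} := by
  choose f hf using κ.exists_rep hE
  refine ⟨f, ⟨?_, ?_, ?_, ?_, ?_⟩, ?_⟩
  · exact fun p q h => (hf p).eq hw (h ▸ hf q)
  · exact (hf ⊥).dir_eq hX hs hw κ.rep_zero
  · exact (hf ⊤).dir_eq hX hs hw κ.rep_one
  · exact fun p => (hf pᶜ).dir_eq hX hs hw (hf p).compl
  · intro p q c
    constructor
    · intro h
      obtain ⟨r, hr⟩ := κ.exists_rep_of_le (sum_base_le h (hf p).1 (hf q).1)
      obtain ⟨h1, rfl⟩ := (κ.sum_iff hX hs hw (hf p) (hf q) hr).1 h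
      exact ⟨h1, (hf _).dir_eq hX hs hw hr⟩
    · rintro ⟨h, rfl⟩
      exact (κ.sum_iff hX hs hw (hf p) (hf q) (hf _)).2 ⟨h, rfl⟩
  · intro C
    ext d
    constructor
    · rintro ⟨p, hp, rfl⟩
      exact (hf p).base_le_iff.2 hp
    · intro hd
      obtain ⟨p, hp⟩ := κ.exists_rep_of_le (le_trans hd (κ.emb_le C))
      exact ⟨p, hp.base_le_iff.1 hd, (hf p).dir_eq hX hs hw hp⟩

/-! ### Elements of the orthodomain as Boolean subalgebras of directions -/

/-- The chart is taken at some `v ≥ w` that is not basic, because a chart at a basic `w` need not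
distinguish `p` from `pᶜ`. -/
theorem exists_carrier_eq (hX : IsOrthodomain X) (hs : IsShort X) (hE : HasEnoughDirections X)
    (w : X) : ∃ S : BSub (ODir X), S.carrier = {d | d.base ≤ w} := by
  obtain ⟨v, hv, hb⟩ := hE.exists_not_isBasic w
  obtain ⟨B, _, ⟨κ⟩⟩ := hX.exists_chart v
  obtain ⟨f, hf, him⟩ := exists_isBoolEmb hX hs hE hb κ
  obtain ⟨C, rfl⟩ := (κ.le_iff w).1 hv
  exact ⟨(BSub.chart hf).emb C, (BSub.carrier_chart hf C).trans (him C)⟩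

theorem exists_of_le_of_carrier_eq (hX : IsOrthodomain X) (hs : IsShort X)
    (hE : HasEnoughDirections X) {w : X} {S T : BSub (ODir X)}
    (hS : S.carrier = {d | d.base ≤ w}) (hT : T ≤ S) :
    ∃ u, T.carrier = {d | d.base ≤ u} := by
  obtain ⟨v, hv, hb⟩ := hE.exists_not_isBasic w
  obtain ⟨B, _, ⟨κ⟩⟩ := hX.exists_chart v
  obtain ⟨f, hf, him⟩ := exists_isBoolEmb hX hs hE hb κ
  obtain ⟨C, rfl⟩ := (κ.le_iff w).1 hv
  have hS' : S = (BSub.chart hf).emb C :=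
    BSub.carrier_injective (hS.trans ((BSub.carrier_chart hf C).trans (him C)).symm)
  subst hS'
  obtain ⟨D, _, rfl⟩ := (BSub.chart hf).exists_of_le hT
  exact ⟨κ.emb D, (BSub.carrier_chart hf D).trans (him D)⟩

/-- `X` is atomistic and every atom is the base of a direction. -/
theorem base_subset_iff (hX : IsOrthodomain X) (hE : HasEnoughDirections X) {v w : X} :
    {d : ODir X | d.base ≤ v} ⊆ {d | d.base ≤ w} ↔ v ≤ w := by
  constructor
  · intro h
    obtain ⟨s, hs, ha⟩ := hX.atomistic.isLUB_atoms v
    refine hs.2 fun a has => ?_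
    obtain ⟨d, hd⟩ := hE.2 a (Or.inr (ha a has))
    have hdv : d.base ≤ v := hd.trans_le (hs.1 has)
    exact hd.symm.trans_le (h hdv)
  · exact fun h d hd => le_trans hd h

/-- A Boolean subalgebra of height at most three lies below an element of `X`. -/
theorem exists_le_of_height_le (hX : IsOrthodomain X) (hs : IsShort X)
    (hE : HasEnoughDirections X) {T : BSub (ODir X)} (hT : Order.height T ≤ 3) :
    ∃ w, T.carrier ⊆ {d | d.base ≤ w} := by
  obtain ⟨_, hT'⟩ := T.isBoolEmb
  have hh : Order.height (⊤ : BooleanSubalgebra T.carrier) ≤ 3 := by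
    rwa [← (BSub.chart hT').height_emb, Chart.emb_top, BSub.ofEmb_val]
  obtain ⟨p, q, r, s, hpq, hpqr, hs', sp, sq, sr, ss⟩ := exists_four_isSmall hh
  have h₁ := (hT'.osum_iff p q _).2 ⟨hpq, rfl⟩
  have h₂ := (hT'.osum_iff (p ⊔ q) r _).2 ⟨hpqr, rfl⟩
  -- The iterated sum puts `p`, `q`, `r` below one `w`; their joins, the complement `s`, and then
  -- every element, being a join of unsplittable pieces, stay below it.
  obtain ⟨w, -, hpw, hqw, hrw⟩ := exists_of_sum_sum hX hs hE h₁ h₂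
  refine ⟨w, fun b hb => ?_⟩
  have hsup : ∀ x y : T.carrier, Disjoint x y → x.1.base ≤ w → y.1.base ≤ w →
      (x ⊔ y).1.base ≤ w := fun x y hxy hx hy =>
    sum_base_le ((hT'.osum_iff x y _).2 ⟨hxy, rfl⟩) hx hy
  have hsw : s.1.base ≤ w := by
    rw [hs', hT'.map_compl]
    exact hsup _ _ hpqr (hsup _ _ hpq hpw hqw) hrw
  have hsm : ∀ x y : T.carrier, IsSmall x → x.1.base ≤ w → (y ⊓ x).1.base ≤ w := by
    intro x y hx hxw
    rcases hx y with h | h <;> rw [h]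
    · rw [hT'.map_bot]
      exact bot_le
    · exact hxw
  have hb' : (⟨b, hb⟩ : T.carrier) = ⟨b, hb⟩ ⊓ p ⊔ ⟨b, hb⟩ ⊓ q ⊔ ⟨b, hb⟩ ⊓ r ⊔ ⟨b, hb⟩ ⊓ s := by
    rw [← inf_sup_left, ← inf_sup_left, ← inf_sup_left, hs', sup_compl_eq_top, inf_top_eq]
  change (⟨b, hb⟩ : T.carrier).1.base ≤ w
  rw [hb']
  have hds : Disjoint (p ⊔ q ⊔ r) s := hs' ▸ disjoint_compl_right
  refine hsup _ _ ?_ (hsup _ _ ?_ (hsup _ _ ?_ (hsm _ _ sp hpw) (hsm _ _ sq hqw))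
    (hsm _ _ sr hrw)) (hsm _ _ ss hsw)
  · rw [← inf_sup_left, ← inf_sup_left]
    exact hds.mono inf_le_right inf_le_right
  · rw [← inf_sup_left]
    exact hpqr.mono inf_le_right inf_le_right
  · exact hpq.mono inf_le_right inf_le_right

theorem nonempty_orderIso (hX : IsOrthodomain X) (hs : IsShort X) (hE : HasEnoughDirections X) :
    Nonempty (X ≃o ShortPart (BSub (ODir X))) := by
  choose F hF using exists_carrier_eq hX hs hE
  have hle : ∀ {v w}, F v ≤ F w ↔ v ≤ w := fun {v w} => by
    rw [BSub.le_iff, hF, hF, base_subset_iff hX hE]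
  have hlow : ∀ T w, T ≤ F w → ∃ u, F u = T := by
    intro T w hT
    obtain ⟨u, hu⟩ := exists_of_le_of_carrier_eq hX hs hE (hF w) hT
    exact ⟨u, BSub.carrier_injective ((hF u).trans hu.symm)⟩
  have hheight : ∀ w, Order.height (F w) ≤ 3 := fun w =>
    (Order.height_orderEmbedding (OrderEmbedding.ofMapLEIff F fun _ _ => hle)
      (fun w T hT => hlow T w hT) w).trans_le (hs w)
  refine ⟨RelIso.ofSurjective (OrderEmbedding.ofMapLEIff
    (fun w => (⟨F w, hheight w⟩ : ShortPart (BSub (ODir X)))) fun _ _ => hle) ?_⟩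
  rintro ⟨T, hT⟩
  obtain ⟨w, hw⟩ := exists_le_of_height_le hX hs hE hT
  obtain ⟨u, hu⟩ := hlow T w (by rw [BSub.le_iff, hF]; exact hw)
  exact ⟨u, Subtype.ext hu⟩

theorem isProperOrthoalgebra (hX : IsOrthodomain X) (hs : IsShort X)
    (hE : HasEnoughDirections X) : IsProperOrthoalgebra (ODir X) := by
  intro S hS
  by_contra! hcard
  -- With at most four elements, `S` is `{0, 1}` or `{0, 1, d, d'}`, so one basic `x` bounds it.
  -- Since `x` is not maximal in `X`, neither is `S` maximal.
  have hsub : ∃ x, IsBasic x ∧ S.carrier ⊆ {d | d.base ≤ x} := by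
    by_cases h : ∃ d ∈ S.carrier, d ≠ zero ∧ d ≠ one
    · obtain ⟨d, hd, h0, h1⟩ := h
      have hO := isOrthoalgebra hX hs hE
      have hne : d ≠ d.compl := by
        intro h
        exact h0 ((hO.sum_self_iff d).1 ⟨one, (hO.sum_eq_one_iff d d).2 h⟩)
      have h0' : d.compl ≠ zero := fun h => h1 (by
        rw [← d.compl_compl, h]; rfl)
      have h1' : d.compl ≠ one := fun h => h0 (by
        rw [← d.compl_compl, h]; exact zero.compl_compl)
      have h01 := zero_ne_one hX hE
      have h4 : ({zero, one, d, d.compl} : Set (ODir X)).encard = 4 := by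
        rw [Set.encard_insert_of_notMem, Set.encard_insert_of_notMem, Set.encard_pair hne]
        · rfl
        · simp [h1.symm, h1'.symm]
        · simp [h0.symm, h0'.symm, h01]
      have hsub : ({zero, one, d, d.compl} : Set (ODir X)) ⊆ S.carrier := by
        rintro _ (rfl | rfl | rfl | rfl)
        · exact S.1.zero_mem
        · exact S.1.one_mem
        · exact hd
        · exact S.1.compl_mem _ hd
      have := Set.Finite.eq_of_subset_of_encard_le (by simp) hsub (hcard.trans h4.ge)
      refine ⟨d.base, d.basic, ?_⟩
      rw [← this]
      rintro e (h | h | h | h) <;> rw [h]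
      · exact bot_le (a := d.base)
      · exact bot_le (a := d.base)
      · exact le_refl d.base
      · exact le_refl d.base
    · push Not at h
      refine ⟨⊥, Or.inl rfl, fun d hd => ?_⟩
      by_cases h0 : d = zero
      · subst h0
        exact le_refl (⊥ : X)
      · rw [h d hd h0]
        exact le_refl (⊥ : X)
  obtain ⟨x, hx, hSx⟩ := hsub
  obtain ⟨y, hxy⟩ := not_isMax_iff.1 fun hm => hE.1 x hm hx
  obtain ⟨T, hT⟩ := exists_carrier_eq hX hs hE y
  have h1 : S ≤ T := by
    rw [BSub.le_iff, hT]
    exact hSx.trans ((base_subset_iff hX hE).2 hxy.le)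
  have h2 := hS h1
  rw [BSub.le_iff, hT] at h2
  exact hxy.not_ge ((base_subset_iff hX hE).1 (h2.trans hSx))

end ODir

end Directions

/-! ### Directions from the elements of an orthoalgebra -/

namespace BooleanSubalgebra

variable {B : Type*} [BooleanAlgebra B]

/-- If `g` cuts `aᶜ` properly, then `a` and `g` generate everything, so neither `g` nor `aᶜ \ g` can
be cut further. If nothing cuts `aᶜ`, then `g = ⊥` serves. -/
theorem exists_of_gen_covBy_top {a : B} (h : gen a ⋖ ⊤) :
    ∃ g, ∀ c ≤ aᶜ, c = ⊥ ∨ c = g ∨ c = aᶜ \ g ∨ c = aᶜ := by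
  by_cases hg : ∃ g ≤ aᶜ, g ≠ ⊥ ∧ g ≠ aᶜ
  · obtain ⟨g, hga, h0, h1⟩ := hg
    have hgm : g ∉ gen a := by
      rintro (rfl | rfl | rfl | rfl)
      · exact h0 rfl
      · exact h0 (by simpa [le_compl_self] using hga)
      · exact h1 rfl
      · exact h1 (top_le_iff.1 hga).symm
    have htop : gen a ⊔ gen g = ⊤ :=
      (h.eq_or_eq le_sup_left le_top).resolve_left fun h' => hgm
        (h' ▸ (le_sup_right : gen g ≤ gen a ⊔ gen g) (self_mem_gen g))
    have hag : a ≤ gᶜ := le_compl_comm.1 hga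
    have hg1 : ∀ c, c ∈ principal gᶜ := by
      have : gen a ⊔ gen g ≤ principal gᶜ := sup_le (gen_le.2 (Or.inl hag))
        (gen_le.2 (mem_principal_compl.2 (Or.inr le_rfl)))
      rw [htop] at this
      exact fun c => this mem_top
    have hg2 : ∀ c, c ∈ principal (aᶜ \ g)ᶜ := by
      have : gen a ⊔ gen g ≤ principal (aᶜ \ g)ᶜ :=
        sup_le (gen_le.2 (Or.inl (le_compl_comm.1 sdiff_le)))
          (gen_le.2 (Or.inl (le_compl_comm.1 (sdiff_eq (x := aᶜ) (y := g) ▸ inf_le_right))))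
      rw [htop] at this
      exact fun c => this mem_top
    have hsup : g ⊔ aᶜ \ g = aᶜ := sup_sdiff_cancel_right hga
    refine ⟨g, fun c hc => ?_⟩
    rcases mem_principal_compl.1 (hg1 c) with h1 | h1 <;>
      rcases mem_principal_compl.1 (hg2 c) with h2 | h2
    · left
      have : c ≤ aᶜ \ g := by rw [sdiff_eq]; exact le_inf hc h1
      exact le_bot_iff.1 (inf_compl_eq_bot (a := aᶜ \ g) ▸ le_inf this h2)
    · right; right; left
      refine le_antisymm ?_ h2
      rw [sdiff_eq]; exact le_inf hc h1
    · right; left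
      refine le_antisymm ?_ h1
      have h3 : c ≤ (g ⊔ aᶜ \ g) ⊓ (aᶜ \ g)ᶜ := le_inf (hc.trans hsup.ge) h2
      rw [inf_sup_right, inf_compl_eq_bot, sup_bot_eq] at h3
      exact h3.trans inf_le_left
    · right; right; right
      exact le_antisymm hc (hsup.ge.trans (sup_le h1 h2))
  · push Not at hg
    refine ⟨⊥, fun c hc => ?_⟩
    by_cases h0 : c = ⊥
    · exact Or.inl h0
    · exact Or.inr (Or.inr (Or.inr (hg c hc h0)))

theorem encard_Iic_le {r : B} (hr : gen r ⋖ ⊤) : (Set.univ : Set (Set.Iic r)).encard ≤ 4 := by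
  rw [← gen_compl] at hr
  obtain ⟨g, hg⟩ := exists_of_gen_covBy_top hr
  rw [compl_compl] at hg
  calc (Set.univ : Set (Set.Iic r)).encard
      ≤ ({⊥, g, r \ g, r} : Set B).encard :=
        Set.encard_le_encard_of_injOn (f := Subtype.val) (fun c _ => hg c.1 c.2)
          Subtype.val_injective.injOn
    _ ≤ 1 + 1 + 1 + 1 := by
      grw [Set.encard_insert_le, Set.encard_insert_le, Set.encard_insert_le,
        Set.encard_singleton]
    _ = 4 := rfl

/-- A member is determined by which of the four pieces cut out by `a` and `t` it contains. -/
theorem encard_sup_gen_le (a t : B) :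
    ((gen a ⊔ gen t : BooleanSubalgebra B) : Set B).encard ≤ 16 := by
  classical
  have key : ∀ u v : B, (u = a ∨ u = aᶜ) → (v = t ∨ v = tᶜ) →
      gen a ⊔ gen t ≤ principal (u ⊓ v)ᶜ := by
    intro u v hu hv
    refine sup_le (gen_le.2 (mem_principal_compl.2 ?_)) (gen_le.2 (mem_principal_compl.2 ?_))
    · rcases hu with rfl | rfl
      · exact Or.inr inf_le_left
      · exact Or.inl (le_compl_comm.1 inf_le_left)
    · rcases hv with rfl | rfl
      · exact Or.inr inf_le_right
      · exact Or.inl (le_compl_comm.1 inf_le_right)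
  let F : B → Bool × Bool × Bool × Bool := fun c =>
    (decide (a ⊓ t ≤ c), decide (a ⊓ tᶜ ≤ c), decide (aᶜ ⊓ t ≤ c), decide (aᶜ ⊓ tᶜ ≤ c))
  have hle : ∀ c ∈ gen a ⊔ gen t, ∀ d, F c = F d → c ≤ d := by
    intro c hc d h
    simp only [F, Prod.mk.injEq, decide_eq_decide] at h
    have aux : ∀ u v : B, (u = a ∨ u = aᶜ) → (v = t ∨ v = tᶜ) → (u ⊓ v ≤ c ↔ u ⊓ v ≤ d) →
        c ⊓ (u ⊓ v) ≤ d := by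
      intro u v hu hv h
      rcases mem_principal_compl.1 (key u v hu hv hc) with h' | h'
      · rw [(le_compl_iff_disjoint_right.1 h').eq_bot]
        exact bot_le
      · exact inf_le_right.trans (h.1 h')
    have hc' : c = c ⊓ (a ⊓ t) ⊔ c ⊓ (a ⊓ tᶜ) ⊔ (c ⊓ (aᶜ ⊓ t) ⊔ c ⊓ (aᶜ ⊓ tᶜ)) := by
      rw [← inf_sup_left, ← inf_sup_left, ← inf_sup_left, ← inf_sup_left, ← inf_sup_left,
        sup_compl_eq_top, inf_top_eq, inf_top_eq, sup_compl_eq_top, inf_top_eq]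
    rw [hc']
    exact sup_le (sup_le (aux _ _ (Or.inl rfl) (Or.inl rfl) h.1)
        (aux _ _ (Or.inl rfl) (Or.inr rfl) h.2.1))
      (sup_le (aux _ _ (Or.inr rfl) (Or.inl rfl) h.2.2.1)
        (aux _ _ (Or.inr rfl) (Or.inr rfl) h.2.2.2))
  calc ((gen a ⊔ gen t : BooleanSubalgebra B) : Set B).encard
      ≤ (Set.univ : Set (Bool × Bool × Bool × Bool)).encard :=
        Set.encard_le_encard_of_injOn (f := F) (fun _ _ => Set.mem_univ _)
          fun c hc d hd h => le_antisymm (hle c hc d h) (hle d hd c h.symm)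
    _ = 16 := by
        rw [Set.encard_univ, ENat.card_eq_coe_fintype_card]
        rfl

end BooleanSubalgebra

/-- The Boolean algebra structure of an initial interval. -/
@[reducible]
def iicBooleanAlgebra {B : Type*} [BooleanAlgebra B] (p : B) : BooleanAlgebra (Set.Iic p) :=
  { (inferInstance : Lattice (Set.Iic p)), (inferInstance : BoundedOrder (Set.Iic p)) with
    le_sup_inf := fun x y z => (le_sup_inf : (x.1 ⊔ y.1) ⊓ (x.1 ⊔ z.1) ≤ x.1 ⊔ y.1 ⊓ z.1)
    compl := fun x => ⟨p \ x.1, sdiff_le⟩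
    inf_compl_le_bot := fun x => by
      change x.1 ⊓ p \ x.1 ≤ ⊥
      rw [inf_sdiff_self_right]
    top_le_sup_compl := fun x => by
      change p ≤ x.1 ⊔ p \ x.1
      rw [sup_sdiff_cancel_right x.2] }

attribute [local instance] iicBooleanAlgebra

/-! ### Pasting Boolean subalgebras of an orthoalgebra -/

namespace IsOrthoalgebra

variable {A : Type u} [OrthoData A]

theorem ocompl_ocompl (hO : IsOrthoalgebra A) (a : A) : ocompl (ocompl a) = a :=
  ((hO.sum_eq_one_iff _ _).1 (hO.sum_comm _ _ _ ((hO.sum_eq_one_iff _ _).2 rfl))).symm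

/-- Regrouping by associativity and commutativity; in particular, parts of summable elements are
summable, which is what lets intervals below complementary elements be pasted. -/
theorem interchange (hO : IsOrthoalgebra A) {i i₂ m j j₂ n t : A}
    (hi : osum i i₂ m) (hj : osum j j₂ n) (ht : osum m n t) : ∃ k k₂, osum i j k ∧ osum i₂ j₂ k₂ ∧ osum k k₂ t := by
  obtain ⟨r, hr, hr'⟩ := hO.sum_assoc _ _ _ _ _ hi ht
  obtain ⟨r₂, h₂, h₂'⟩ := hO.sum_assoc _ _ _ _ _ hj (hO.sum_comm _ _ _ hr)
  obtain ⟨k, hk, hk'⟩ := hO.sum_assoc _ _ _ _ _ (hO.sum_comm _ _ _ h₂') (hO.sum_comm _ _ _ hr')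
  exact ⟨k, r₂, hO.sum_comm _ _ _ hk, hO.sum_comm _ _ _ h₂, hO.sum_comm _ _ _ hk'⟩

/-- Injectivity comes from the order: if `f a = f b`, then `f a ⊕ f bᶜ = 1` is defined, so `a` is
disjoint from `bᶜ`. -/
theorem isBoolEmb_of_osum_iff (hO : IsOrthoalgebra A) {B : Type*} [BooleanAlgebra B]
    {f : B → A} (hf : f ⊤ = oone)
    (h : ∀ a b c, osum (f a) (f b) c ↔ Disjoint a b ∧ f (a ⊔ b) = c) : IsBoolEmb f := by
  have hc : ∀ a, f aᶜ = ocompl (f a) := fun a =>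
    (hO.sum_eq_one_iff _ _).1 ((h a aᶜ _).2 ⟨disjoint_compl_right, by rw [sup_compl_eq_top, hf]⟩)
  have hle : ∀ a b, f a = f b → a ≤ b := by
    intro a b hab
    have : osum (f a) (f bᶜ) oone := (hO.sum_eq_one_iff _ _).2 (by rw [hc, hab])
    have := ((h _ _ _).1 this).1
    rw [← compl_compl b]
    exact le_compl_iff_disjoint_right.2 this
  refine ⟨fun a b hab => le_antisymm (hle a b hab) (hle b a hab.symm), ?_, hf, hc, h⟩
  exact (hO.sum_self_iff _).1 ⟨f (⊥ ⊔ ⊥), (h _ _ _).2 ⟨disjoint_bot_left, rfl⟩⟩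

/-- Two Boolean subalgebras with complementary elements `p` and `q` can be pasted along the
intervals below `p` and `q`. -/
theorem exists_paste (hO : IsOrthoalgebra A) {P Q : Type*} [BooleanAlgebra P]
    [BooleanAlgebra Q] {g : P → A} {h : Q → A} (hg : IsBoolEmb g) (hh : IsBoolEmb h)
    {p : P} {q : Q} (hpq : h q = ocompl (g p)) :
    ∃ f : Set.Iic p × Set.Iic q → A, IsBoolEmb f ∧ ∀ x, osum (g x.1) (h x.2) (f x) := by
  have hsplit : ∀ x : Set.Iic p × Set.Iic q, ∃ c, osum (g x.1) (h x.2) c := by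
    rintro ⟨⟨i, hi⟩, ⟨j, hj⟩⟩
    have h1 := (hg.osum_iff i (p \ i) (g p)).2 ⟨disjoint_sdiff_self_right,
      by rw [sup_sdiff_cancel_right hi]⟩
    have h2 := (hh.osum_iff j (q \ j) (h q)).2 ⟨disjoint_sdiff_self_right,
      by rw [sup_sdiff_cancel_right hj]⟩
    obtain ⟨k, -, hk, -⟩ := hO.interchange h1 h2 ((hO.sum_eq_one_iff _ _).2 hpq)
    exact ⟨k, hk⟩
  choose f hf using hsplit
  refine ⟨f, hO.isBoolEmb_of_osum_iff ?_ ?_, hf⟩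
  · exact hO.sum_unique _ _ _ _ (hf ⊤) ((hO.sum_eq_one_iff _ _).2 hpq)
  · intro x y c
    have hdisj : Disjoint x y ↔ Disjoint x.1.1 y.1.1 ∧ Disjoint x.2.1 y.2.1 := by
      rw [Prod.disjoint_iff, disjoint_iff, disjoint_iff, disjoint_iff, disjoint_iff,
        Subtype.ext_iff, Subtype.ext_iff]
      rfl
    constructor
    · intro hc
      obtain ⟨m, n, hm, hn, hmn⟩ := hO.interchange (hf x) (hf y) hc
      obtain ⟨h1, rfl⟩ := (hg.osum_iff _ _ _).1 hm
      obtain ⟨h2, rfl⟩ := (hh.osum_iff _ _ _).1 hn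
      exact ⟨hdisj.2 ⟨h1, h2⟩, hO.sum_unique _ _ _ _ (hf (x ⊔ y)) hmn⟩
    · rintro ⟨hd, rfl⟩
      obtain ⟨h1, h2⟩ := hdisj.1 hd
      obtain ⟨k, k₂, hk, hk₂, h3⟩ := hO.interchange ((hg.osum_iff _ _ _).2 ⟨h1, rfl⟩)
        ((hh.osum_iff _ _ _).2 ⟨h2, rfl⟩) (hf (x ⊔ y))
      rwa [hO.sum_unique _ _ _ _ (hf x) hk, hO.sum_unique _ _ _ _ (hf y) hk₂]

end IsOrthoalgebra

/-- Since `pᶜ` is unsplittable, `b` lies below `p` or is a part of `p` joined with `pᶜ`, and `pᶜ`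
has the same image as `q`. Hence the pasted algebra contains the whole image of `g`. -/
theorem IsBoolEmb.exists_osum_of_principal_eq_top {P Q : Type*} [BooleanAlgebra P]
    [BooleanAlgebra Q] {A : Type u} [OrthoData A] {g : P → A} {h : Q → A} (hg : IsBoolEmb g) (hh : IsBoolEmb h)
    {p : P} {q : Q} (hpq : h q = ocompl (g p)) (hp : principal p = ⊤) (b : P) :
    ∃ i ≤ p, ∃ j ≤ q, osum (g i) (h j) (g b) := by
  have hb : b ∈ principal p := hp ▸ mem_top
  rcases hb with hb | hb
  · refine ⟨b, hb, ⊥, bot_le, ?_⟩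
    rw [hh.map_bot, ← hg.map_bot, hg.osum_iff]
    simp
  · refine ⟨b ⊓ p, inf_le_right, q, le_rfl, ?_⟩
    rw [hpq, ← hg.map_compl, hg.osum_iff]
    refine ⟨disjoint_compl_right.mono_left inf_le_right, ?_⟩
    rw [sup_inf_right, sup_compl_eq_top, inf_top_eq, sup_eq_left.2 hb]

theorem BSub.height_ofEmb_le {A : Type u} [OrthoData A] {P Q : Type*} [BooleanAlgebra P]
    [BooleanAlgebra Q] {p : P} {q : Q} (hp : gen p ⋖ ⊤) (hq : gen q ⋖ ⊤)
    {f : Set.Iic p × Set.Iic q → A} (hf : IsBoolEmb f) : Order.height (BSub.ofEmb hf) ≤ 3 := by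
  have hcard : ((⊤ : BooleanSubalgebra (Set.Iic p × Set.Iic q)) :
      Set (Set.Iic p × Set.Iic q)).encard ≤ 2 ^ (3 + 1) := by
    rw [coe_top, ← Set.univ_prod_univ, Set.encard_prod]
    calc _ ≤ (4 : ℕ∞) * 4 := mul_le_mul' (encard_Iic_le hp) (encard_Iic_le hq)
      _ = 2 ^ (3 + 1) := by norm_num
  have := height_le_of_encard_le 3 _ hcard
  rwa [← (BSub.chart hf).height_emb, Chart.emb_top] at this

/-! ### The short part of the Boolean subalgebras of a proper orthoalgebra -/

namespace BSub

variable {A : Type u} [OrthoData A]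

/-- The Boolean algebra structure of a Boolean subalgebra. -/
@[reducible]
noncomputable def booleanAlgebra (S : BSub A) : BooleanAlgebra S.carrier := S.isBoolEmb.choose

attribute [local instance] booleanAlgebra

theorem isBoolEmb_val (S : BSub A) : IsBoolEmb (Subtype.val : S.carrier → A) :=
  S.isBoolEmb.choose_spec

/-- The order is expressed by sums in `A`, hence does not depend on the Boolean subalgebra or on the
Boolean structure chosen for it. -/
theorem coe_le_iff {S : BSub A} {a b : S.carrier} :
    a ≤ b ↔ ∃ c, osum a.1 (ocompl b.1) c := by
  rw [← S.isBoolEmb_val.map_compl]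
  constructor
  · exact fun h => ⟨_, (S.isBoolEmb_val.osum_iff _ _ _).2
      ⟨disjoint_compl_right.mono_left h, rfl⟩⟩
  · rintro ⟨c, h⟩
    rw [← compl_compl b]
    exact le_compl_iff_disjoint_right.2 ((S.isBoolEmb_val.osum_iff _ _ _).1 h).1

theorem mem_principal_congr {S T : BSub A} {a b : S.carrier} {a' b' : T.carrier}
    (ha : a.1 = a'.1) (hb : b.1 = b'.1) : b ∈ principal a ↔ b' ∈ principal a' := by
  rw [mem_principal, mem_principal, coe_le_iff, coe_le_iff, coe_le_iff, coe_le_iff,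
    S.isBoolEmb_val.map_compl, T.isBoolEmb_val.map_compl, ha, hb]

theorem image_gen {S : BSub A} (a : S.carrier) :
    Subtype.val '' (gen a : Set S.carrier) = {ozero, a.1, ocompl a.1, oone} := by
  change Subtype.val '' {⊥, a, aᶜ, ⊤} = _
  rw [Set.image_insert_eq, Set.image_insert_eq, Set.image_pair, S.isBoolEmb_val.map_bot,
    S.isBoolEmb_val.map_top, S.isBoolEmb_val.map_compl]

section Short

variable {X : Type u} [PartialOrder X] (σ : X ↪o BSub A)

theorem exists_of_le_apply (hσ : ∀ T, Order.height T ≤ 3 ↔ ∃ x, σ x = T)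
    {T : BSub A} {x : X} (h : T ≤ σ x) : ∃ y, σ y = T :=
  (hσ T).1 ((Order.height_mono h).trans ((hσ _).2 ⟨x, rfl⟩))

theorem isShort (hσ : ∀ T, Order.height T ≤ 3 ↔ ∃ x, σ x = T) : IsShort X := fun x =>
  (Order.height_orderEmbedding σ (fun _ _ h => exists_of_le_apply σ hσ h) x).symm.trans_le
    ((hσ _).2 ⟨x, rfl⟩)

theorem exists_chart (hσ : ∀ T, Order.height T ≤ 3 ↔ ∃ x, σ x = T) (w : X) :
    ∃ κ : Chart w (σ w).carrier,
    ∀ D, (σ (κ.emb D)).carrier = Subtype.val '' (D : Set (σ w).carrier) := by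
  have hw : ∀ D, (chart (σ w).isBoolEmb_val).emb D ≤ σ w := fun D =>
    (Chart.emb_le _ D).trans_eq (ofEmb_val _ _)
  choose F hF using fun D => exists_of_le_apply σ hσ (hw D)
  refine ⟨⟨OrderEmbedding.ofMapLEIff F fun D E => ?_, fun x => ⟨fun hx => ?_, ?_⟩⟩, fun D => ?_⟩
  · rw [← σ.le_iff_le, hF, hF, OrderEmbedding.le_iff_le]
  · obtain ⟨D, hD⟩ := ((chart (σ w).isBoolEmb_val).le_iff (σ x)).1
      ((σ.monotone hx).trans_eq (ofEmb_val _ _).symm)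
    exact ⟨D, σ.injective ((hF D).trans hD)⟩
  · rintro ⟨D, rfl⟩
    exact σ.le_iff_le.1 ((hF D).trans_le (hw D))
  · exact (congrArg carrier (hF D)).trans (carrier_chart _ D)

end Short

theorem isGLB_of_carrier_eq {X : Type u} [PartialOrder X] (σ : X ↪o BSub A) {u v w : X}
    (h : (σ w).carrier = (σ u).carrier ∩ (σ v).carrier) : IsGLB {u, v} w := by
  constructor
  · rintro _ (rfl | rfl)
    · exact σ.le_iff_le.1 (h.subset.trans Set.inter_subset_left)
    · exact σ.le_iff_le.1 (h.subset.trans Set.inter_subset_right)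
  · intro x hx
    have h1 : x ≤ u := hx (Set.mem_insert _ _)
    have h2 : x ≤ v := hx (Set.mem_insert_of_mem _ rfl)
    rw [← σ.le_iff_le, le_iff, h]
    exact Set.subset_inter (σ.monotone h1) (σ.monotone h2)

theorem image_principal {S T : BSub A} (h : S ≤ T) {a : S.carrier} {b : T.carrier}
    (hab : a.1 = b.1) : Subtype.val '' (principal a : Set S.carrier) =
      S.carrier ∩ Subtype.val '' (principal b : Set T.carrier) := by
  ext c
  constructor
  · rintro ⟨c, hc, rfl⟩
    exact ⟨c.2, ⟨c.1, h c.2⟩, (mem_principal_congr hab rfl).1 hc, rfl⟩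
  · rintro ⟨hc, c, hc', rfl⟩
    exact ⟨⟨c.1, hc⟩, (mem_principal_congr hab rfl).2 hc', rfl⟩

end BSub

/-- The chain `⊥ < x < y < u` already uses up height three. -/
theorem IsShort.covBy {X : Type u} [PartialOrder X] [OrderBot X] (hs : IsShort X) {x y u : X}
    (hx : x ≠ ⊥) (hxy : x < y) (hyu : y < u) : y ⋖ u := by
  refine ⟨hyu, fun t h1 h2 => ?_⟩
  have e1 := Order.height_add_one_le (bot_lt_iff_ne_bot.2 hx)
  have e2 := Order.height_add_one_le hxy
  have e3 := Order.height_add_one_le h1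
  have e4 := Order.height_add_one_le h2
  have : (4 : ℕ∞) ≤ 3 := by
    calc (4 : ℕ∞) = 0 + 1 + 1 + 1 + 1 := rfl
      _ ≤ Order.height (⊥ : X) + 1 + 1 + 1 + 1 := by gcongr; exact zero_le
      _ ≤ Order.height u := by grw [e1, e2, e3, e4]
      _ ≤ 3 := hs u
  exact absurd this (by decide)

namespace BSub

attribute [local instance] booleanAlgebra iicBooleanAlgebra

variable {A : Type u} [OrthoData A] {X : Type u} [PartialOrder X] [OrderBot X]
  (σ : X ↪o BSub A)

/-- If `a` is an atom of `y` and its complement an atom of `z`, then `y ⊔ z` exists and covers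
both. -/
theorem exists_isLUB (hO : IsOrthoalgebra A) (hσ : ∀ T, Order.height T ≤ 3 ↔ ∃ x, σ x = T)
    {x y z : X} (κy : Chart y (σ y).carrier) (κz : Chart z (σ z).carrier)
    {a : (σ y).carrier} {b : (σ z).carrier} (hab : a.1 = b.1)
    (hay : κy.emb (gen a) = x) (hbz : κz.emb (gen b) = x) (hxy : x ⋖ y) (hxz : x ⋖ z)
    (hyz : y ≠ z) (hx : x ≠ ⊥) (ha : principal aᶜ = ⊤) (hb : principal b = ⊤) :
    ∃ u, IsLUB {y, z} u ∧ y ⋖ u ∧ z ⋖ u := by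
  have hpq : (b : A) = ocompl (aᶜ).1 := by
    rw [(σ y).isBoolEmb_val.map_compl, hO.ocompl_ocompl, hab]
  have hqp : (aᶜ).1 = ocompl (b : A) := by
    rw [(σ y).isBoolEmb_val.map_compl, hab]
  have hga : gen aᶜ ⋖ ⊤ := by
    rw [gen_compl, ← κy.emb_covBy, κy.emb_top, hay]
    exact hxy
  have hgb : gen b ⋖ ⊤ := by
    rw [← κz.emb_covBy, κz.emb_top, hbz]
    exact hxz
  obtain ⟨f, hf, hsum⟩ := hO.exists_paste (σ y).isBoolEmb_val (σ z).isBoolEmb_val hpq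
  -- Both pasted intervals have at most four elements because `x` is covered by `y` and `z`; so the
  -- pasted algebra has height at most 3 and comes from an element of `X`.
  obtain ⟨u, hu⟩ := (hσ _).1 (height_ofEmb_le hga hgb hf)
  have hcu : (σ u).carrier = Set.range f := congrArg carrier hu
  have hyu : y ≤ u := by
    rw [← σ.le_iff_le, le_iff, hcu]
    intro c hc
    obtain ⟨i, hi, j, hj, h⟩ := IsBoolEmb.exists_osum_of_principal_eq_top (σ y).isBoolEmb_val
      (σ z).isBoolEmb_val hpq ha ⟨c, hc⟩
    exact ⟨(⟨i, hi⟩, ⟨j, hj⟩), hO.sum_unique _ _ _ _ (hsum _) h⟩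
  have hzu : z ≤ u := by
    rw [← σ.le_iff_le, le_iff, hcu]
    intro c hc
    obtain ⟨j, hj, i, hi, h⟩ := IsBoolEmb.exists_osum_of_principal_eq_top (σ z).isBoolEmb_val
      (σ y).isBoolEmb_val hqp hb ⟨c, hc⟩
    exact ⟨(⟨i, hi⟩, ⟨j, hj⟩), hO.sum_unique _ _ _ _ (hsum _) (hO.sum_comm _ _ _ h)⟩
  have hs := isShort σ hσ
  refine ⟨u, ⟨?_, fun v hv => ?_⟩, hs.covBy hx hxy.lt (lt_of_le_of_ne hyu ?_),
    hs.covBy hx hxz.lt (lt_of_le_of_ne hzu ?_)⟩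
  · rintro _ (rfl | rfl)
    · exact hyu
    · exact hzu
  · have h1 : y ≤ v := hv (Set.mem_insert _ _)
    have h2 : z ≤ v := hv (Set.mem_insert_of_mem _ rfl)
    rw [← σ.le_iff_le, le_iff, hcu]
    rintro _ ⟨p, rfl⟩
    exact (σ v).1.sum_mem _ (σ.monotone h1 p.1.1.2) _ (σ.monotone h2 p.2.1.2) _ (hsum p)
  · rintro rfl
    rcases hxy.eq_or_eq hxz.le hzu with h | h
    · exact hxz.ne h.symm
    · exact hyz h.symm
  · rintro rfl
    rcases hxz.eq_or_eq hxy.le hyu with h | h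
    · exact hxy.ne h.symm
    · exact hyz h

/-- A generator `a` of `x` is one fixed element of `A`, so taking at each `w` the principal pair of
`a` orients all `w ≥ x` coherently. Condition (iii) is the pasting lemma `exists_isLUB`. -/
theorem exists_direction (hO : IsOrthoalgebra A)
    (hσ : ∀ T, Order.height T ≤ 3 ↔ ∃ x, σ x = T) {x : X} (hx : IsBasic x) :
    ∃ d : ODir X, d.base = x := by
  choose κ hκ using exists_chart σ hσ
  obtain ⟨a, ha⟩ := (κ x).exists_gen hx le_rfl
  let i : ∀ w : Set.Ici x, (σ w.1).carrier := fun w => ⟨a.1, σ.monotone w.2 a.2⟩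
  have hgen : ∀ w : Set.Ici x, (κ w.1).emb (gen (i w)) = x := by
    intro w
    apply σ.injective
    apply carrier_injective
    conv_rhs => rw [← ha]
    rw [hκ, hκ, image_gen, image_gen]
  have hcompl : ∀ v w : Set.Ici x, ((i v)ᶜ).1 = ((i w)ᶜ).1 := fun v w => by
    rw [isBoolEmb_val _ |>.map_compl, isBoolEmb_val _ |>.map_compl]
  have hrestr : ∀ v w : Set.Ici x, v ≤ w → ∀ (p : (σ v.1).carrier) (q : (σ w.1).carrier),
      p.1 = q.1 → IsGLB {v.1, (κ w.1).emb (principal q)} ((κ v.1).emb (principal p)) := by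
    intro v w hvw p q hpq
    apply isGLB_of_carrier_eq σ
    rw [hκ, hκ]
    exact image_principal (σ.monotone hvw) hpq
  refine ⟨⟨x, hx, fun w => ((κ w.1).emb (principal (i w)), (κ w.1).emb (principal (i w)ᶜ)),
    fun w => ?_, fun v w hvw => ⟨hrestr v w hvw _ _ rfl, hrestr v w hvw _ _ (hcompl v w)⟩,
    fun y z hy hz hvy hvz => ?_⟩, rfl⟩
  · have := (κ w.1).isPrincipalPairBelow (i w)
    rwa [hgen w] at this
  · have hyz : y.1 ≠ z.1 := by
      intro h
      obtain rfl : y = z := Subtype.ext h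
      exact hy.ne (Prod.ext_iff.1 (hvy.symm.trans hvz)).1
    have htop : ∀ (w : X) (D : BooleanSubalgebra (σ w).carrier), (κ w).emb D = w → D = ⊤ :=
      fun w D h => (κ w).emb.injective (h.trans (κ w).emb_top.symm)
    have h1 : principal (i y)ᶜ = ⊤ := htop _ _ (Prod.ext_iff.1 hvy).2
    have h2 : principal (i z) = ⊤ := htop _ _ (Prod.ext_iff.1 hvz).1
    refine exists_isLUB σ hO hσ (κ y.1) (κ z.1) rfl (hgen y) (hgen z) hy hz hyz ?_ h1 h2
    -- If `x = ⊥`, then `a` is `0` or `1`, and one of the two principal subalgebras assumed to be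
    -- everything would be `⊥`.
    intro hx0
    have h3 := (hgen z).trans (hx0.trans (κ z.1).emb_bot.symm)
    rw [(κ z.1).emb.injective.eq_iff, gen_eq_bot] at h3
    have hne : ∀ w : X, x ⋖ w → (⊥ : BooleanSubalgebra (σ w).carrier) ≠ ⊤ := by
      intro w hw h
      exact hw.ne (hx0.trans ((κ w).emb_bot.symm.trans
        ((congrArg (κ w).emb h).trans (κ w).emb_top)))
    rcases h3 with h3 | h3
    · rw [h3, principal_bot] at h2
      exact hne _ hz h2
    · have h4 : i y = ⊤ := Subtype.ext <| by
        have := congrArg Subtype.val h3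
        rw [isBoolEmb_val _ |>.map_top] at this ⊢
        exact this
      rw [h4, compl_top, principal_bot] at h1
      exact hne _ hy h1

/-- A basic `x` has at most four elements, so some Boolean subalgebra contains it together with a
further element `t`. A generator of `x` and `t` generate at most 16 elements, hence height at most
3, so this enlargement of `x` already occurs in `X`. -/
theorem isProperOrthodomain (hσ : ∀ T, Order.height T ≤ 3 ↔ ∃ x, σ x = T)
    (hP : IsProperOrthoalgebra A) : IsProperOrthodomain X := by
  intro x hx hb
  obtain ⟨κ, hκ⟩ := exists_chart σ hσ x
  obtain ⟨a, ha⟩ := κ.exists_gen hb le_rfl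
  have hcar : (σ x).carrier = {ozero, a.1, ocompl a.1, oone} := by
    conv_lhs => rw [← ha]
    rw [hκ, image_gen]
  have hcard : (σ x).carrier.encard ≤ 4 := by
    rw [hcar]
    calc _ ≤ (1 + 1 + 1 + 1 : ℕ∞) := by
          grw [Set.encard_insert_le, Set.encard_insert_le, Set.encard_insert_le,
            Set.encard_singleton]
      _ = 4 := rfl
  obtain ⟨T, hT⟩ := not_isMax_iff.1 fun h => hcard.not_gt (hP _ h)
  obtain ⟨t, ht, htx⟩ := Set.exists_of_ssubset (show (σ x).carrier ⊂ T.carrier from hT)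
  let κT := chart T.isBoolEmb_val
  have hD : ∀ D, (κT.emb D).carrier = Subtype.val '' (D : Set T.carrier) := carrier_chart _
  let D := gen (⟨a.1, hT.le a.2⟩ : T.carrier) ⊔ gen ⟨t, ht⟩
  obtain ⟨y, hy⟩ := (hσ (κT.emb D)).1 (by
    rw [κT.height_emb]
    exact height_le_of_encard_le 3 _ ((encard_sup_gen_le _ _).trans (by norm_num)))
  have hxy : x ≤ y := by
    rw [← σ.le_iff_le, hy, le_iff, hD, hcar, ← image_gen (⟨a.1, hT.le a.2⟩ : T.carrier)]
    exact Set.image_mono (le_sup_left : gen _ ≤ D)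
  have hyx := σ.monotone (hx hxy)
  rw [hy, le_iff, hD] at hyx
  exact htx (hyx ⟨⟨t, ht⟩, (le_sup_right : gen _ ≤ D) (self_mem_gen _), rfl⟩)

end BSub

theorem isShort_and_hasEnoughDirections {X : Type u} [PartialOrder X] [OrderBot X] {A : Type u}
    [OrthoData A] (hO : IsOrthoalgebra A) (hP : IsProperOrthoalgebra A)
    (ψ : X ≃o ShortPart (BSub A)) : IsShort X ∧ HasEnoughDirections X := by
  let σ : X ↪o BSub A := ψ.toOrderEmbedding.trans (OrderEmbedding.subtype _)
  have hσ : ∀ T, Order.height T ≤ 3 ↔ ∃ x, σ x = T := by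
    intro T
    constructor
    · exact fun h => ⟨ψ.symm ⟨T, h⟩, congrArg Subtype.val (ψ.apply_symm_apply ⟨T, h⟩)⟩
    · rintro ⟨x, rfl⟩
      exact (ψ x).2
  exact ⟨BSub.isShort σ hσ, BSub.isProperOrthodomain σ hσ hP,
    fun x hx => BSub.exists_direction σ hO hσ hx⟩

theorem mainTheorem6 {X : Type u} [PartialOrder X] [OrderBot X] (hX : IsOrthodomain X) :
    ((IsShort X ∧ HasEnoughDirections X) ↔
      ∃ (A : Type u) (_ : OrthoData A), IsOrthoalgebra A ∧ IsProperOrthoalgebra A ∧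
        Nonempty (X ≃o ShortPart (BSub A))) ∧
    ((IsShort X ∧ HasEnoughDirections X) →
      IsOrthoalgebra (ODir X) ∧ Nonempty (X ≃o ShortPart (BSub (ODir X)))) := by
  refine ⟨⟨fun h => ?_, ?_⟩, fun h => ?_⟩
  · exact ⟨ODir X, inferInstance, ODir.isOrthoalgebra hX h.1 h.2,
      ODir.isProperOrthoalgebra hX h.1 h.2, ODir.nonempty_orderIso hX h.1 h.2⟩
  · rintro ⟨A, _, hO, hP, ⟨ψ⟩⟩
    exact isShort_and_hasEnoughDirections hO hP ψ
  · exact ⟨ODir.isOrthoalgebra hX h.1 h.2, ODir.nonempty_orderIso hX h.1 h.2⟩
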